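/- **Notation.** For $\gamma\in Sp_2(\mathbb Z)$ (integral symplectic $4\times4$ matrices) write $\gamma=\begin{pmatrix}A_\gamma&B_\gamma\\C_\gamma&D_\gamma\end{pmatrix}$ in $2\times2$ blocks, and let $\Gamma_0(N)=\{\gamma\in Sp_2(\mathbb Z):C_\gamma\equiv0\ (N)\}$ and $\Gamma_\infty^+=\{\gamma\in Sp_2(\mathbb Z):C_\gamma=0,\ \det D_\gamma=1\}$. Let $\mathfrak h=\{\tau=X+iY\in\mathbb C^{2,2}:{}^t\tau=\tau,\ Y>0\}$. For a function $f$ on $\mathfrak h$, an integer $k$ and a real symplectic similitude $\gamma$ with $\det\gamma>0$, put $$(f|\gamma)(\tau)=(\det\gamma)^{k/2}\det(C_\gamma\tau+D_\gamma)^{-k}f\big((A_\gamma\tau+B_\gamma)(C_\gamma\tau+D_\gamma)^{-1}\big).$$ Let $k\ge4$ be an integer, let $N=N_0N_1N_2$ be a square-free positive integer, $\rho=(N_0,N_1,N_2)$, and let $\chi=\chi_{N_0}\chi_{N_1}\chi_{N_2}$ be a Dirichlet character modulo $N$, where $\chi_{N_i}$ is a character modulo $N_i$ and $\chi_{N_1}^2=1$.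 Let $M_\rho$ be an integral diagonal $2\times2$ matrix such that, for every prime $p\mid N$, $M_\rho\equiv0$, $\begin{pmatrix}1&\\&0\end{pmatrix}$ or $I$ modulo $p$ according as $p\mid N_0$, $p\mid N_1$ or $p\mid N_2$, and put $\gamma_\rho=\begin{pmatrix}I&0\\M_\rho&I\end{pmatrix}$. The Eisenstein series $\mathbb E_\rho$ of weight $k$, level $N$ and character $\chi$ is $$\mathbb E_\rho(\tau)=\tfrac12\sum_{\gamma}\overline\chi(\det D_\gamma)\,(1|\gamma_\rho\gamma)(\tau),\qquad \tau\in\mathfrak h,$$ where $\gamma$ runs over elements of $\Gamma_0(N)$ such that $\Gamma_\infty^+\gamma_\rho\gamma$ runs once over the $\Gamma_0(N)$-orbit of $\Gamma_\infty^+\gamma_\rho$. For a prime $p$ let $\delta=\begin{pmatrix}pI&\\&I\end{pmatrix}$ and $$f|T(p)=p^{k-3}\sum_\gamma\overline\chi(\det D_\gamma)\,f|\delta^{-1}\gamma,$$ where $\gamma$ runs over representatives of $(\delta\Gamma_0(N)\delta^{-1}\cap\Gamma_0(N))\backslash\Gamma_0(N)$. **Proposition 3.5.** Let $q$ be a prime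 dividing $N_2$. Then the series $\mathbb E_\rho(\tau)$ converges absolutely for every $\tau\in\mathfrak h$, and on $\mathfrak h$ $$\mathbb E_\rho\,|\,T(q)=\chi_{N_0}(q^2)\,\chi_{N_1}(q)\,q^{2k-3}\,\mathbb E_\rho .$$ -/

import Mathlib

open scoped ComplexConjugate

noncomputable section

namespace SiegelDegTwo

/-- Complex `2 × 2` matrices, among which the points of the Siegel upper half space lie. -/
abbrev Mat2C : Type := Matrix (Fin 2) (Fin 2) ℂ

/-- The integral symplectic group of `4 × 4` matrices, in `2 × 2` blocks. -/
abbrev Sp2Z : Type := Matrix.symplecticGroup (Fin 2) ℤ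

/-- The Siegel upper half space of degree two: symmetric `τ = X + iY` with `Y > 0`. -/
def halfSpace : Set Mat2C :=
  {τ | τ.IsSymm ∧ (τ.map Complex.im).PosDef}

/-- The lower left block `C` of `γ = (A B; C D)`. -/
def blockC (γ : Sp2Z) : Matrix (Fin 2) (Fin 2) ℤ :=
  (γ : Matrix (Fin 2 ⊕ Fin 2) (Fin 2 ⊕ Fin 2) ℤ).toBlocks₂₁

/-- The lower right block `D` of `γ = (A B; C D)`. -/
def blockD (γ : Sp2Z) : Matrix (Fin 2) (Fin 2) ℤ :=
  (γ : Matrix (Fin 2 ⊕ Fin 2) (Fin 2 ⊕ Fin 2) ℤ).toBlocks₂₂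

theorem blockC_one : blockC 1 = 0 := by
  ext i j
  simp [blockC, Matrix.toBlocks₂₁]

theorem blockD_one : blockD 1 = 1 := by
  ext i j
  simp [blockD, Matrix.toBlocks₂₂, Matrix.one_apply]

theorem blockC_mul (γ γ' : Sp2Z) :
    blockC (γ * γ') =
      blockC γ * (γ' : Matrix (Fin 2 ⊕ Fin 2) (Fin 2 ⊕ Fin 2) ℤ).toBlocks₁₁
        + blockD γ * blockC γ' := by
  ext i j
  simp [blockC, blockD, Matrix.toBlocks₂₁, Matrix.toBlocks₂₂, Matrix.toBlocks₁₁,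
    Matrix.mul_apply, Fintype.sum_sum_type]

theorem blockD_mul (γ γ' : Sp2Z) :
    blockD (γ * γ') =
      blockC γ * (γ' : Matrix (Fin 2 ⊕ Fin 2) (Fin 2 ⊕ Fin 2) ℤ).toBlocks₁₂
        + blockD γ * blockD γ' := by
  ext i j
  simp [blockC, blockD, Matrix.toBlocks₂₁, Matrix.toBlocks₂₂, Matrix.toBlocks₁₂,
    Matrix.mul_apply, Fintype.sum_sum_type]

theorem blockC_inv (γ : Sp2Z) : blockC γ⁻¹ = -(blockC γ).transpose := by
  ext i j
  simp [blockC, SymplecticGroup.coe_inv, Matrix.J, Matrix.toBlocks₂₁, Matrix.mul_apply,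
    Fintype.sum_sum_type, Matrix.fromBlocks_neg, Matrix.one_apply]

/-- The group `Γ₀(N)` of integral symplectic matrices with `C ≡ 0 (N)`. -/
def Gamma0 (N : ℕ) : Subgroup Sp2Z where
  carrier := {γ | ∀ i j, (N : ℤ) ∣ blockC γ i j}
  one_mem' := by
    intro i j
    simp [blockC_one]
  mul_mem' := by
    intro γ γ' h h' i j
    rw [blockC_mul, Matrix.add_apply, Matrix.mul_apply, Matrix.mul_apply]
    exact dvd_add (Finset.dvd_sum fun l _ => (h i l).mul_right _)
      (Finset.dvd_sum fun l _ => (h' l j).mul_left _)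
  inv_mem' := by
    intro γ h i j
    rw [blockC_inv, Matrix.neg_apply, Matrix.transpose_apply]
    exact (dvd_neg).2 (h j i)

/-- The subgroup `Γ∞⁺` of those `γ` with `C = 0` and `det D = 1`. Two symplectic matrices with lower
block rows `(M N)` and `(M' N')` lie in the same right coset of it if and only if
`(M' N') = G (M N)` for some `G ∈ SL₂(ℤ)`. It has index two in the group `Γ∞` of all `γ` with
`C = 0`. -/
def GammaInfPlus : Subgroup Sp2Z where
  carrier := {γ | blockC γ = 0 ∧ (blockD γ).det = 1}
  one_mem' := by
    simp [blockC_one, blockD_one]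
  mul_mem' := by
    rintro γ γ' ⟨h, hd⟩ ⟨h', hd'⟩
    refine ⟨by simp [blockC_mul, h, h'], ?_⟩
    rw [blockD_mul, h, Matrix.zero_mul, zero_add, Matrix.det_mul, hd, hd', one_mul]
  inv_mem' := by
    rintro γ ⟨h, hd⟩
    refine ⟨by rw [blockC_inv, h]; simp, ?_⟩
    have h1 : blockD (γ * γ⁻¹) = 1 := by rw [mul_inv_cancel, blockD_one]
    rw [blockD_mul, h, Matrix.zero_mul, zero_add] at h1
    have h2 := congrArg Matrix.det h1
    rwa [Matrix.det_mul, hd, one_mul, Matrix.det_one] at h2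

/-- The matrix `γ_ρ = (I 0; M_ρ I)` with `M_ρ` the diagonal matrix with entries `d`. -/
def cuspMatrix (d : Fin 2 → ℤ) : Sp2Z :=
  ⟨Matrix.fromBlocks 1 0 (Matrix.diagonal d) 1, by
    rw [SymplecticGroup.mem_iff]
    simp [Matrix.J, Matrix.fromBlocks_transpose, Matrix.fromBlocks_multiply]⟩

/-- The diagonal matrix `M_ρ` with entries `d` belongs to the partition `ρ = (N₀, N₁, N₂)`: modulo
each prime `p` it is `0` if `p ∣ N₀`, `diag(1, 0)` if `p ∣ N₁`, and `I` if `p ∣ N₂`. -/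
def IsCuspFor (N₀ N₁ N₂ : ℕ) (d : Fin 2 → ℤ) : Prop :=
  ∀ p : ℕ, p.Prime →
    (p ∣ N₀ → (Matrix.diagonal d).map (Int.cast : ℤ → ZMod p) = 0) ∧
    (p ∣ N₁ → (Matrix.diagonal d).map (Int.cast : ℤ → ZMod p) = Matrix.diagonal ![1, 0]) ∧
    (p ∣ N₂ → (Matrix.diagonal d).map (Int.cast : ℤ → ZMod p) = 1)

/-- The subgroup of those `γ ∈ Γ₀(N)` that fix the coset `Γ∞⁺ γ_ρ` under right multiplication. -/
def cuspStabilizer (N : ℕ) (d : Fin 2 → ℤ) : Subgroup (Gamma0 N) :=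
  (GammaInfPlus.comap (MulAut.conj (cuspMatrix d)).toMonoidHom).subgroupOf (Gamma0 N)

/-- The index set of the Eisenstein series, the right cosets of the stabilizer in `Γ₀(N)`. The coset
of `γ` stands for the coset `Γ∞⁺ γ_ρ γ` in the `Γ₀(N)`-orbit of `Γ∞⁺ γ_ρ`, in other words for the
`SL₂(ℤ)`-equivalence class of the coprime symmetric pair `(M_ρ I) γ`. -/
abbrev CuspOrbit (N : ℕ) (d : Fin 2 → ℤ) : Type :=
  Quotient (QuotientGroup.rightRel (cuspStabilizer N d))

/-- The function `1|γ (τ) = det(Cτ + D)⁻ᵏ`. -/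
def oneSlash (k : ℕ) (γ : Sp2Z) (τ : Mat2C) : ℂ :=
  (((blockC γ).map (Int.cast : ℤ → ℂ) * τ + (blockD γ).map (Int.cast : ℤ → ℂ)).det)
    ^ (-(k : ℤ))

/-- The summand `conj χ(det D_γ) · 1|(γ_ρ γ) (τ)` of the Eisenstein series for `γ ∈ Γ₀(N)`. -/
def eisensteinTerm (N k : ℕ) (χ : DirichletCharacter ℂ N) (d : Fin 2 → ℤ)
    (γ : Gamma0 N) (τ : Mat2C) : ℂ :=
  conj (χ (((blockD (γ : Sp2Z)).det : ℤ) : ZMod N)) * oneSlash k (cuspMatrix d * γ) τ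

/-- The Eisenstein series `E_ρ`. The sum over the `SL₂(ℤ)`-equivalence classes in the orbit is
`2 E_ρ`, because every `GL₂(ℤ)`-equivalence class (that is, every coset of `Γ∞`) in the orbit
consists of two `SL₂(ℤ)`-equivalence classes, whose summands differ by the factor
`χ(-1) (-1)ᵏ`. -/
def eisenstein (N k : ℕ) (χ : DirichletCharacter ℂ N) (d : Fin 2 → ℤ) (τ : Mat2C) : ℂ :=
  (1 / 2) * ∑' c : CuspOrbit N d, eisensteinTerm N k χ d (Quotient.out c) τ

/-- The slash operator
`(f|γ)(τ) = (det γ)^(k/2) det(Cτ + D)⁻ᵏ f((Aτ + B)(Cτ + D)⁻¹)` of weight `k`, for `γ = (A B; C D)`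
a real symplectic similitude with `det γ > 0`. -/
def slash (k : ℕ) (f : Mat2C → ℂ)
    (γ : Matrix (Fin 2 ⊕ Fin 2) (Fin 2 ⊕ Fin 2) ℝ) (τ : Mat2C) : ℂ :=
  let A : Mat2C := γ.toBlocks₁₁.map Complex.ofReal
  let B : Mat2C := γ.toBlocks₁₂.map Complex.ofReal
  let C : Mat2C := γ.toBlocks₂₁.map Complex.ofReal
  let D : Mat2C := γ.toBlocks₂₂.map Complex.ofReal
  ((γ.det ^ ((k : ℝ) / 2) : ℝ) : ℂ) * (C * τ + D).det ^ (-(k : ℤ))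
    * f ((A * τ + B) * (C * τ + D)⁻¹)

/-- The matrix `δ = diag(p I, I)`. -/
def heckeDelta (R : Type) [CommRing R] (p : ℕ) :
    Matrix (Fin 2 ⊕ Fin 2) (Fin 2 ⊕ Fin 2) R :=
  Matrix.fromBlocks ((p : R) • 1) 0 0 1

/-- The subgroup `δ Γ₀(N) δ⁻¹ ∩ Γ₀(N)` of `Γ₀(N)`; the condition `γ = δ γ' δ⁻¹` is written without
the inverse as `δ γ' = γ δ`. -/
def heckeSubgroup (N p : ℕ) : Subgroup (Gamma0 N) where
  carrier := {γ | ∃ γ' : Gamma0 N,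
    heckeDelta ℤ p * ((γ' : Sp2Z) : Matrix (Fin 2 ⊕ Fin 2) (Fin 2 ⊕ Fin 2) ℤ)
      = ((γ : Sp2Z) : Matrix (Fin 2 ⊕ Fin 2) (Fin 2 ⊕ Fin 2) ℤ) * heckeDelta ℤ p}
  one_mem' := ⟨1, by simp⟩
  mul_mem' := by
    rintro γ₁ γ₂ ⟨η₁, h₁⟩ ⟨η₂, h₂⟩
    refine ⟨η₁ * η₂, ?_⟩
    simp only [Subgroup.coe_mul, Submonoid.coe_mul]
    rw [← Matrix.mul_assoc, h₁, Matrix.mul_assoc, h₂, Matrix.mul_assoc]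
  inv_mem' := by
    rintro γ ⟨η, h⟩
    refine ⟨η⁻¹, ?_⟩
    have e₁ : ((γ⁻¹ : Gamma0 N) : Sp2Z).1 * (γ : Sp2Z).1 = 1 :=
      congrArg (fun g : Gamma0 N => (g : Sp2Z).1) (inv_mul_cancel γ)
    have e₂ : (η : Sp2Z).1 * ((η⁻¹ : Gamma0 N) : Sp2Z).1 = 1 :=
      congrArg (fun g : Gamma0 N => (g : Sp2Z).1) (mul_inv_cancel η)
    calc heckeDelta ℤ p * ((η⁻¹ : Gamma0 N) : Sp2Z).1
        = (((γ⁻¹ : Gamma0 N) : Sp2Z).1 * (γ : Sp2Z).1) * heckeDelta ℤ p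
            * ((η⁻¹ : Gamma0 N) : Sp2Z).1 := by rw [e₁, Matrix.one_mul]
      _ = ((γ⁻¹ : Gamma0 N) : Sp2Z).1 * (heckeDelta ℤ p * (η : Sp2Z).1)
            * ((η⁻¹ : Gamma0 N) : Sp2Z).1 := by rw [h]; simp only [Matrix.mul_assoc]
      _ = ((γ⁻¹ : Gamma0 N) : Sp2Z).1 * heckeDelta ℤ p := by
            simp only [Matrix.mul_assoc]; rw [e₂, Matrix.mul_one]

/-- The Hecke operator
`f|T(p) = p^(k-3) ∑_γ conj χ(det D_γ) f|δ⁻¹γ`, with `γ` over representatives of the finitely many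
right cosets of `δ Γ₀(N) δ⁻¹ ∩ Γ₀(N)` in `Γ₀(N)`. -/
def heckeT (N k : ℕ) (χ : DirichletCharacter ℂ N) (p : ℕ) (f : Mat2C → ℂ) (τ : Mat2C) : ℂ :=
  (p : ℂ) ^ ((k : ℤ) - 3) *
    ∑ᶠ c : Quotient (QuotientGroup.rightRel (heckeSubgroup N p)),
      conj (χ (((blockD ((Quotient.out c : Gamma0 N) : Sp2Z)).det : ℤ) : ZMod N)) *
        slash k f ((heckeDelta ℝ p)⁻¹ *
          (((Quotient.out c : Gamma0 N) : Sp2Z) :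
            Matrix (Fin 2 ⊕ Fin 2) (Fin 2 ⊕ Fin 2) ℤ).map (Int.cast : ℤ → ℝ)) τ

end SiegelDegTwo

end

open scoped ComplexConjugate

noncomputable section

namespace SiegelDegTwo

/-! Convergence. Modulo `SL₂(ℤ)` a lower half `(C D)` is determined by its `2 × 2` minors, so the
cosets inject into the nonzero integral points of a quadric cone in five variables
(`mul_inv_mem_GammaInfPlus_of_plucker_eq`), and `det(Cτ + D)` is a linear form in these coordinates.
For `τ` in the half space this form has no nonzero real zero on the cone, so by compactness it is
bounded below by a multiple of the norm (`exists_le_norm_coneLin`). A divisor bound for the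
solutions of `v₀v₁ + v₂² + v₃v₄ = 0` then gives convergence of the sum of the inverse fourth powers
(`summable_cone`).

Hecke action. Slashing the term of `(C D)` with `δ⁻¹g` gives `q ^ k` times the term of `(C, qD)g`
(`slash_oneSlash`). Since `q ∣ N₂`, `M_ρ` is the identity modulo `q`, and every `C` in the orbit is
invertible modulo `q`. Hence for each class `(C D)` exactly one Hecke coset of `g` makes the right
block of `(C D)g⁻¹` divisible by `q`; the translation by `-C⁻¹D` modulo `q` realises it. Dividing
that block by `q` stays in the orbit, so pairs of a Hecke coset and a class correspond bijectively
to classes (`exists_heckeEquiv`), and the double sum is the Eisenstein series again.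

The eigenvalue comes from the characters (`character_det_eq`): replacing `D` by `qD` multiplies the
determinant of the underlying element of `Γ₀(N)` by `q²` modulo `N₀`, by `q` times the square of a
unit modulo `N₁`, and by `1` modulo `N₂`. With `q ^ (k - 3) * q ^ k` this is the asserted factor. -/

/-! ### Divisor bounds -/

theorem exists_card_divisors_le_mul_rpow :
    ∃ K : ℝ, 0 < K ∧ ∀ n : ℕ, n ≠ 0 → (n.divisors.card : ℝ) ≤ K * (n : ℝ) ^ (1 / 4 : ℝ) := by
  -- At most sixteen primes lie below 16, and each costs a factor 16; larger primes cost nothing.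
  refine ⟨16 ^ 16, by positivity, fun n hn => ?_⟩
  have key : ∀ p ∈ n.primeFactors, ((n.factorization p + 1 : ℕ) : ℝ) ≤
      (if p < 16 then 16 else 1) * ((p : ℝ) ^ n.factorization p) ^ (1 / 4 : ℝ) := by
    intro p hp
    have hp2 : 2 ≤ p := (Nat.prime_of_mem_primeFactors hp).two_le
    set e := n.factorization p
    have hb : ((p : ℝ) ^ e) ^ (1 / 4 : ℝ) = ((p : ℝ) ^ (1 / 4 : ℝ)) ^ e := by
      rw [← Real.rpow_natCast, ← Real.rpow_mul (by positivity), mul_comm,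
        Real.rpow_mul (by positivity), Real.rpow_natCast]
    rw [hb]
    have hlow : ∀ b : ℝ, 0 ≤ b → b ^ 4 ≤ p → b ≤ (p : ℝ) ^ (1 / 4 : ℝ) := by
      intro b hb0 hb4
      have := Real.rpow_le_rpow (by positivity) hb4 (by norm_num : (0 : ℝ) ≤ 1 / 4)
      rwa [← Real.rpow_natCast, ← Real.rpow_mul hb0,
        show ((4 : ℕ) : ℝ) * (1 / 4) = 1 by norm_num, Real.rpow_one] at this
    push_cast
    split_ifs with h
    -- `(17/16)⁴ ≤ 2 ≤ p`, and by Bernoulli `16 (17/16)^e ≥ 16 + e`. For `p ≥ 16` the base 2 serves,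
    -- as `2⁴ = 16`.
    · have h1 := hlow (17 / 16) (by norm_num) (by
        have : (2 : ℝ) ≤ p := by exact_mod_cast hp2
        exact le_trans (by norm_num) this)
      have h2 := one_add_mul_le_pow (a := (1 / 16 : ℝ)) (by norm_num) e
      have h3 : (1 + 1 / 16 : ℝ) ^ e ≤ ((p : ℝ) ^ (1 / 4 : ℝ)) ^ e :=
        pow_le_pow_left₀ (by norm_num) (by linarith) e
      linarith
    · have h1 := hlow 2 (by norm_num) (by
        have : (16 : ℝ) ≤ p := by exact_mod_cast not_lt.1 h
        exact le_trans (by norm_num) this)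
      have h2 := one_add_mul_le_pow (a := (1 : ℝ)) (by norm_num) e
      have h3 : (1 + 1 : ℝ) ^ e ≤ ((p : ℝ) ^ (1 / 4 : ℝ)) ^ e :=
        pow_le_pow_left₀ (by norm_num) (by linarith) e
      have h4 := h2.trans h3
      linarith
  rw [Nat.card_divisors hn, Nat.cast_prod]
  refine (Finset.prod_le_prod (fun _ _ => by positivity) key).trans ?_
  rw [Finset.prod_mul_distrib, Real.finsetProd_rpow _ _ (fun _ _ => by positivity)]
  have hprod : ∏ p ∈ n.primeFactors, (p : ℝ) ^ n.factorization p = n := by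
    conv_rhs => rw [← Nat.prod_factorization_pow_eq_self hn]
    rw [Nat.prod_factorization_eq_prod_primeFactors]
    push_cast; rfl
  rw [hprod]
  refine mul_le_mul_of_nonneg_right ?_ (by positivity)
  rw [Finset.prod_ite, Finset.prod_const, Finset.prod_const, one_pow, mul_one]
  refine pow_le_pow_right₀ (by norm_num) ?_
  calc _ ≤ (Finset.range 16).card := Finset.card_le_card (fun p hp => by
          simpa using (Finset.mem_filter.1 hp).2)
    _ = 16 := by simp

/-- A family bounded by `g ∘ π` is summable when the fibres of `π` are counted by finite sets whose
cardinalities, weighted by `g`, are summable. -/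
theorem summable_of_fiber_card {V A B : Type*} {f : V → ℝ} (g : B → ℝ) (π : V → B) (σ : V → A)
    (F : B → Finset A) (hf : ∀ v, 0 ≤ f v) (hg : ∀ b, 0 ≤ g b) (hfg : ∀ v, f v ≤ g (π v))
    (hσ : ∀ v, σ v ∈ F (π v)) (hinj : ∀ v v', π v = π v' → σ v = σ v' → v = v')
    (hs : Summable fun b => ((F b).card : ℝ) * g b) : Summable f := by
  have h1 : Summable fun p : Σ b, F b => g p.1 := by
    rw [summable_sigma_of_nonneg (fun p => hg p.1)]
    refine ⟨fun b => Summable.of_finite, ?_⟩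
    simpa using hs
  have hi : Function.Injective fun v : V => (⟨π v, σ v, hσ v⟩ : Σ b, F b) := by
    intro v v' h
    have hπ : π v = π v' := congrArg Sigma.fst h
    have hσ' : σ v = σ v' := congrArg (fun p : Σ b, F b => (p.2 : A)) h
    exact hinj v v' hπ hσ'
  exact Summable.of_nonneg_of_le hf hfg (h1.comp_injective hi)

/-- The integral divisors of an integer, of either sign. -/
def intDivisors (n : ℤ) : Finset ℤ :=
  (n.natAbs.divisors ×ˢ ({1, -1} : Finset ℤ)).image fun p => p.2 * p.1

theorem mem_intDivisors {n a b : ℤ} (hn : n ≠ 0) (h : a * b = n) : a ∈ intDivisors n := by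
  refine Finset.mem_image.2 ⟨(a.natAbs, a.sign), ?_, Int.sign_mul_natAbs a⟩
  have ha : a ≠ 0 := by rintro rfl; simp at h; exact hn h.symm
  refine Finset.mem_product.2 ⟨?_, ?_⟩
  · exact Nat.mem_divisors.2 ⟨Int.natAbs_dvd_natAbs.2 ⟨b, h.symm⟩, Int.natAbs_ne_zero.2 hn⟩
  · rcases lt_or_gt_of_ne ha with h | h
    · simp [Int.sign_eq_neg_one_of_neg h]
    · simp [Int.sign_eq_one_of_pos h]

/-- The range `2 * m ^ 2` fits `n = -(x ^ 2 + y * z)` with `x, y, z` bounded by `m`. -/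
theorem exists_card_intDivisors_le_mul_rpow :
    ∃ K : ℝ, 0 < K ∧ ∀ (n : ℤ) (m : ℝ), 1 ≤ m → |(n : ℝ)| ≤ 2 * m ^ 2 →
      ((intDivisors n).card : ℝ) ≤ K * m ^ (1 / 2 : ℝ) := by
  obtain ⟨K, hK, h⟩ := exists_card_divisors_le_mul_rpow
  refine ⟨2 * K * 2 ^ (1 / 4 : ℝ), by positivity, fun n m hm hnm => ?_⟩
  have h1 : ((intDivisors n).card : ℝ) ≤ 2 * n.natAbs.divisors.card := by
    have : (intDivisors n).card ≤ n.natAbs.divisors.card * 2 :=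
      Finset.card_image_le.trans (by rw [Finset.card_product]; rfl)
    rw [mul_comm]; exact_mod_cast this
  -- `Nat.divisors 0` is empty, so the case `n = 0` is harmless.
  by_cases hn : n = 0
  · subst hn
    have : ((intDivisors 0).card : ℝ) = 0 := by simp [intDivisors]
    rw [this]; positivity
  have h2 := h n.natAbs (Int.natAbs_ne_zero.2 hn)
  have h3 : ((n.natAbs : ℕ) : ℝ) = |(n : ℝ)| := by
    rw [Nat.cast_natAbs]; simp
  rw [h3] at h2
  have h4 : |(n : ℝ)| ^ (1 / 4 : ℝ) ≤ 2 ^ (1 / 4 : ℝ) * m ^ (1 / 2 : ℝ) := by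
    refine (Real.rpow_le_rpow (abs_nonneg _) hnm (by norm_num)).trans (le_of_eq ?_)
    rw [Real.mul_rpow (by norm_num) (by positivity), ← Real.rpow_natCast m 2,
      ← Real.rpow_mul (by positivity)]
    norm_num
  calc ((intDivisors n).card : ℝ) ≤ 2 * (K * |(n : ℝ)| ^ (1 / 4 : ℝ)) := by linarith
    _ ≤ 2 * (K * (2 ^ (1 / 4 : ℝ) * m ^ (1 / 2 : ℝ))) := by gcongr
    _ = _ := by ring

/-! ### Summation over the integral points of the cone -/

theorem summable_one_add_abs_rpow {r : ℝ} (hr : r < -1) :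
    Summable fun n : ℤ => (1 + |(n : ℝ)|) ^ r := by
  have h : Summable fun n : ℤ => |(n : ℝ)| ^ r :=
    Real.summable_abs_int_rpow (b := -r) (by linarith) |>.congr (fun n => by simp)
  have h' : Summable fun n : ℤ => (if n = 0 then (1 : ℝ) else 0) + |(n : ℝ)| ^ r :=
    (summable_of_ne_finset_zero (s := {0}) (by intro b hb; simpa using hb)).add h
  refine Summable.of_nonneg_of_le (fun n => by positivity) (fun n => ?_) h'
  by_cases hn : n = 0
  · subst hn; simp [Real.zero_rpow_nonneg]
  · have : 0 < |(n : ℝ)| := abs_pos.2 (by exact_mod_cast hn)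
    simp only [hn, if_false, zero_add]
    exact Real.rpow_le_rpow_of_nonpos this (by linarith) (by linarith)

/-- The exponent `-7/2` is the weight `-4` plus the `1/2` lost to the divisor bound. It is split
evenly over the variables; each share, `-7/4` here and `-7/6` for three variables, is below `-1`. -/
theorem summable_rpow_prod {m : ℤ × ℤ → ℝ} (h₁ : ∀ b, 1 + |(b.1 : ℝ)| ≤ m b)
    (h₂ : ∀ b, 1 + |(b.2 : ℝ)| ≤ m b) : Summable fun b => m b ^ (-(7 / 2) : ℝ) := by
  have h := summable_one_add_abs_rpow (r := -(7 / 4)) (by norm_num)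
  have hm : ∀ b, 0 < m b := fun b => lt_of_lt_of_le (by positivity) (h₁ b)
  refine Summable.of_nonneg_of_le (fun b => Real.rpow_nonneg (hm b).le _) (fun b => ?_)
    (h.mul_of_nonneg h (fun _ => by positivity) (fun _ => by positivity))
  rw [show (-(7 / 2) : ℝ) = -(7 / 4) + -(7 / 4) by norm_num, Real.rpow_add (hm b)]
  exact mul_le_mul (Real.rpow_le_rpow_of_nonpos (by positivity) (h₁ b) (by norm_num))
    (Real.rpow_le_rpow_of_nonpos (by positivity) (h₂ b) (by norm_num))
    (Real.rpow_nonneg (hm b).le _) (by positivity)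

theorem summable_rpow_prod_three {m : ℤ × ℤ × ℤ → ℝ} (h₁ : ∀ b, 1 + |(b.1 : ℝ)| ≤ m b)
    (h₂ : ∀ b, 1 + |(b.2.1 : ℝ)| ≤ m b) (h₃ : ∀ b, 1 + |(b.2.2 : ℝ)| ≤ m b) :
    Summable fun b => m b ^ (-(7 / 2) : ℝ) := by
  have h := summable_one_add_abs_rpow (r := -(7 / 6)) (by norm_num)
  have hm : ∀ b, 0 < m b := fun b => lt_of_lt_of_le (by positivity) (h₁ b)
  refine Summable.of_nonneg_of_le (fun b => Real.rpow_nonneg (hm b).le _) (fun b => ?_)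
    (h.mul_of_nonneg (h.mul_of_nonneg h (fun _ => by positivity) (fun _ => by positivity))
      (fun _ => by positivity) (fun _ => by positivity))
  rw [show (-(7 / 2) : ℝ) = -(7 / 6) + (-(7 / 6) + -(7 / 6)) by norm_num, Real.rpow_add (hm b),
    Real.rpow_add (hm b)]
  exact mul_le_mul (Real.rpow_le_rpow_of_nonpos (by positivity) (h₁ b) (by norm_num))
    (mul_le_mul (Real.rpow_le_rpow_of_nonpos (by positivity) (h₂ b) (by norm_num))
      (Real.rpow_le_rpow_of_nonpos (by positivity) (h₃ b) (by norm_num))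
      (Real.rpow_nonneg (hm b).le _) (by positivity))
    (mul_nonneg (Real.rpow_nonneg (hm b).le _) (Real.rpow_nonneg (hm b).le _)) (by positivity)

/-- The quadratic form of signature `(2, 3)` whose isotropic vectors are the Plücker coordinates of
the Lagrangian planes in a symplectic space of dimension four. -/
def coneForm {R : Type*} [CommRing R] (v : Fin 5 → R) : R :=
  v 0 * v 1 + v 2 ^ 2 + v 3 * v 4

/-- The real vector with the same entries as an integral vector. -/
def toReal (v : Fin 5 → ℤ) : Fin 5 → ℝ := fun i => v i

theorem abs_le_norm_toReal (v : Fin 5 → ℤ) (i : Fin 5) : |(v i : ℝ)| ≤ ‖toReal v‖ :=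
  norm_le_pi_norm (toReal v) i

theorem rpow_half_mul_rpow_neg_four {m : ℝ} (hm : 0 < m) :
    m ^ (1 / 2 : ℝ) * m ^ (-4 : ℝ) = m ^ (-(7 / 2) : ℝ) := by
  rw [← Real.rpow_add hm]; norm_num

/-- Given `v₂, v₃, v₄`, the entry `v₀` divides the nonzero integer `-(v₂² + v₃v₄)` and determines
`v₁`, so a fibre has `O(m ^ (1/2))` points. -/
theorem summable_cone_of_mul_ne_zero :
    Summable ({v : Fin 5 → ℤ | coneForm v = 0 ∧ v 0 * v 1 ≠ 0}.indicator
      fun v => (1 + ‖toReal v‖) ^ (-4 : ℝ)) := by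
  rw [← summable_subtype_iff_indicator]
  obtain ⟨K, hK, hcard⟩ := exists_card_intDivisors_le_mul_rpow
  let m : ℤ × ℤ × ℤ → ℝ := fun b => 1 + max |(b.1 : ℝ)| (max |(b.2.1 : ℝ)| |(b.2.2 : ℝ)|)
  have hm₁ : ∀ b, 1 + |(b.1 : ℝ)| ≤ m b := fun b => by simp [m]
  have hm₂ : ∀ b, 1 + |(b.2.1 : ℝ)| ≤ m b := fun b => by simp [m]
  have hm₃ : ∀ b, 1 + |(b.2.2 : ℝ)| ≤ m b := fun b => by simp [m]
  have hm : ∀ b, 1 ≤ m b := fun b => le_trans (by simp) (hm₁ b)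
  refine summable_of_fiber_card (fun b => m b ^ (-4 : ℝ)) (fun v => (v.1 2, v.1 3, v.1 4))
    (fun v => v.1 0) (fun b => intDivisors (-(b.1 ^ 2 + b.2.1 * b.2.2)))
    (fun v => Real.rpow_nonneg (by positivity) _)
    (fun b => Real.rpow_nonneg (by linarith [hm b]) _) ?_ ?_ ?_ ?_
  · intro v
    refine Real.rpow_le_rpow_of_nonpos (by linarith [hm (v.1 2, v.1 3, v.1 4)]) ?_ (by norm_num)
    simp only [m]
    gcongr
    exact max_le (abs_le_norm_toReal _ _) (max_le (abs_le_norm_toReal _ _)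
      (abs_le_norm_toReal _ _))
  · rintro ⟨v, h, h0⟩
    have e : v 0 * v 1 = -(v 2 ^ 2 + v 3 * v 4) := by
      unfold coneForm at h; linarith
    exact mem_intDivisors (e ▸ h0) e
  · rintro ⟨v, h, h0⟩ ⟨v', h', h0'⟩ hπ hσ
    simp only [Prod.mk.injEq] at hπ hσ
    obtain ⟨h2, h3, h4⟩ := hπ
    have h1 : v 1 = v' 1 := by
      unfold coneForm at h h'
      apply mul_left_cancel₀ (left_ne_zero_of_mul h0)
      rw [h2, h3, h4] at h
      rw [← hσ] at h'
      linarith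
    ext i
    fin_cases i <;> assumption
  · refine Summable.of_nonneg_of_le (fun b => mul_nonneg (by positivity)
      (Real.rpow_nonneg (by linarith [hm b]) _)) (fun b => ?_)
      ((summable_rpow_prod_three hm₁ hm₂ hm₃).mul_left K)
    rw [← rpow_half_mul_rpow_neg_four (by linarith [hm b]), ← mul_assoc]
    refine mul_le_mul_of_nonneg_right (hcard _ _ (hm b) ?_) (Real.rpow_nonneg (by linarith [hm b]) _)
    push_cast
    have a1 : |(b.1 : ℝ)| ≤ m b := by linarith [hm₁ b]
    have a2 : |(b.2.1 : ℝ)| ≤ m b := by linarith [hm₂ b]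
    have a3 : |(b.2.2 : ℝ)| ≤ m b := by linarith [hm₃ b]
    rw [abs_neg]
    refine (abs_add_le _ _).trans ?_
    rw [abs_pow, abs_mul, two_mul, sq (m b)]
    have := hm b
    exact add_le_add (by rw [sq]; gcongr) (by gcongr)

/-- One of `v₀, v₁` vanishes, so their sum leaves two choices for the pair, and `v₃` divides the
nonzero integer `-v₂²`. Two free parameters remain. -/
theorem summable_cone_of_mul_eq_zero_of_ne :
    Summable ({v : Fin 5 → ℤ | coneForm v = 0 ∧ v 0 * v 1 = 0 ∧ v 3 * v 4 ≠ 0}.indicator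
      fun v => (1 + ‖toReal v‖) ^ (-4 : ℝ)) := by
  rw [← summable_subtype_iff_indicator]
  obtain ⟨K, hK, hcard⟩ := exists_card_intDivisors_le_mul_rpow
  let m : ℤ × ℤ → ℝ := fun b => 1 + max |(b.1 : ℝ)| |(b.2 : ℝ)|
  have hm₁ : ∀ b, 1 + |(b.1 : ℝ)| ≤ m b := fun b => by simp [m]
  have hm₂ : ∀ b, 1 + |(b.2 : ℝ)| ≤ m b := fun b => by simp [m]
  have hm : ∀ b, 1 ≤ m b := fun b => le_trans (by simp) (hm₁ b)
  refine summable_of_fiber_card (fun b => m b ^ (-4 : ℝ)) (fun v => (v.1 0 + v.1 1, v.1 2))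
    (fun v => (v.1 0, v.1 3)) (fun b => ({0, b.1} : Finset ℤ) ×ˢ intDivisors (-(b.2 ^ 2)))
    (fun v => Real.rpow_nonneg (by positivity) _)
    (fun b => Real.rpow_nonneg (by linarith [hm b]) _) ?_ ?_ ?_ ?_
  · rintro ⟨v, h, h0, h3⟩
    refine Real.rpow_le_rpow_of_nonpos (by linarith [hm (v 0 + v 1, v 2)]) ?_ (by norm_num)
    simp only [m]
    gcongr
    refine max_le ?_ (abs_le_norm_toReal _ _)
    rcases mul_eq_zero.1 h0 with h | h <;> simp [h, abs_le_norm_toReal]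
  · rintro ⟨v, h, h0, h3⟩
    have e : v 3 * v 4 = -(v 2 ^ 2) := by
      unfold coneForm at h; linarith
    refine Finset.mem_product.2 ⟨?_, mem_intDivisors (e ▸ h3) e⟩
    rcases mul_eq_zero.1 h0 with h | h <;> simp [h]
  · rintro ⟨v, h, h0, h3⟩ ⟨v', h', h0', h3'⟩ hπ hσ
    simp only [Prod.mk.injEq] at hπ hσ
    obtain ⟨h1, h2⟩ := hπ
    obtain ⟨e0, e3⟩ := hσ
    have e1 : v 1 = v' 1 := by linarith
    have e4 : v 4 = v' 4 := by
      unfold coneForm at h h'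
      apply mul_left_cancel₀ (left_ne_zero_of_mul h3)
      rw [h2, h0] at h
      rw [h0', ← e3] at h'
      linarith
    ext i
    fin_cases i <;> assumption
  · refine Summable.of_nonneg_of_le (fun b => mul_nonneg (by positivity)
      (Real.rpow_nonneg (by linarith [hm b]) _)) (fun b => ?_)
      ((summable_rpow_prod hm₁ hm₂).mul_left (2 * K))
    rw [← rpow_half_mul_rpow_neg_four (by linarith [hm b]), ← mul_assoc]
    refine mul_le_mul_of_nonneg_right ?_ (Real.rpow_nonneg (by linarith [hm b]) _)
    have a2 : |(b.2 : ℝ)| ≤ m b := by linarith [hm₂ b]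
    have hc := hcard (-(b.2 ^ 2)) (m b) (hm b) (by
      push_cast
      rw [abs_neg, abs_pow]
      have : |(b.2 : ℝ)| ^ 2 ≤ m b ^ 2 := by gcongr
      linarith [sq_nonneg (m b)])
    have h2 : ((({0, b.1} : Finset ℤ).card : ℕ) : ℝ) ≤ 2 := by
      exact_mod_cast Finset.card_le_two
    rw [Finset.card_product, Nat.cast_mul, mul_assoc]
    exact mul_le_mul h2 hc (by positivity) (by norm_num)

/-- Here `v₂ = 0`, and the sums `v₀ + v₁` and `v₃ + v₄` determine the vector up to four choices. -/
theorem summable_cone_of_mul_eq_zero_of_eq :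
    Summable ({v : Fin 5 → ℤ | coneForm v = 0 ∧ v 0 * v 1 = 0 ∧ v 3 * v 4 = 0}.indicator
      fun v => (1 + ‖toReal v‖) ^ (-4 : ℝ)) := by
  rw [← summable_subtype_iff_indicator]
  let m : ℤ × ℤ → ℝ := fun b => 1 + max |(b.1 : ℝ)| |(b.2 : ℝ)|
  have hm₁ : ∀ b, 1 + |(b.1 : ℝ)| ≤ m b := fun b => by simp [m]
  have hm₂ : ∀ b, 1 + |(b.2 : ℝ)| ≤ m b := fun b => by simp [m]
  have hm : ∀ b, 1 ≤ m b := fun b => le_trans (by simp) (hm₁ b)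
  refine summable_of_fiber_card (fun b => m b ^ (-4 : ℝ)) (fun v => (v.1 0 + v.1 1, v.1 3 + v.1 4))
    (fun v => (v.1 0, v.1 3)) (fun b => ({0, b.1} : Finset ℤ) ×ˢ {0, b.2})
    (fun v => Real.rpow_nonneg (by positivity) _)
    (fun b => Real.rpow_nonneg (by linarith [hm b]) _) ?_ ?_ ?_ ?_
  · rintro ⟨v, h, h0, h3⟩
    refine Real.rpow_le_rpow_of_nonpos (by linarith [hm (v 0 + v 1, v 3 + v 4)]) ?_ (by norm_num)
    simp only [m]
    gcongr
    refine max_le ?_ ?_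
    · rcases mul_eq_zero.1 h0 with h | h <;> simp [h, abs_le_norm_toReal]
    · rcases mul_eq_zero.1 h3 with h | h <;> simp [h, abs_le_norm_toReal]
  · rintro ⟨v, h, h0, h3⟩
    refine Finset.mem_product.2 ⟨?_, ?_⟩
    · rcases mul_eq_zero.1 h0 with h | h <;> simp [h]
    · rcases mul_eq_zero.1 h3 with h | h <;> simp [h]
  · rintro ⟨v, h, h0, h3⟩ ⟨v', h', h0', h3'⟩ hπ hσ
    simp only [Prod.mk.injEq] at hπ hσ
    obtain ⟨h1, h4⟩ := hπ
    obtain ⟨e0, e3⟩ := hσ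
    have e1 : v 1 = v' 1 := by linarith
    have e4 : v 4 = v' 4 := by linarith
    have e2 : v 2 = v' 2 := by
      unfold coneForm at h h'
      rw [h0, h3] at h
      rw [h0', h3'] at h'
      rw [pow_eq_zero_iff two_ne_zero |>.1 (by linarith : v 2 ^ 2 = 0),
        pow_eq_zero_iff two_ne_zero |>.1 (by linarith : v' 2 ^ 2 = 0)]
    ext i
    fin_cases i <;> assumption
  · refine Summable.of_nonneg_of_le (fun b => mul_nonneg (by positivity)
      (Real.rpow_nonneg (by linarith [hm b]) _)) (fun b => ?_)
      ((summable_rpow_prod hm₁ hm₂).mul_left 4)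
    refine mul_le_mul ?_ (Real.rpow_le_rpow_of_exponent_le (hm b) (by norm_num))
      (Real.rpow_nonneg (by linarith [hm b]) _) (by norm_num)
    rw [Finset.card_product]
    exact_mod_cast Nat.mul_le_mul (Finset.card_le_two (a := 0) (b := b.1))
      (Finset.card_le_two (a := 0) (b := b.2))

theorem summable_cone :
    Summable ({v : Fin 5 → ℤ | coneForm v = 0}.indicator
      fun v => (1 + ‖toReal v‖) ^ (-4 : ℝ)) := by
  have hnn : ∀ v : Fin 5 → ℤ, 0 ≤ (1 + ‖toReal v‖) ^ (-4 : ℝ) :=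
    fun v => Real.rpow_nonneg (by positivity) _
  refine Summable.of_nonneg_of_le (fun v => Set.indicator_nonneg (fun v _ => hnn v) v)
    (fun v => ?_) (summable_cone_of_mul_ne_zero.add
      (summable_cone_of_mul_eq_zero_of_ne.add summable_cone_of_mul_eq_zero_of_eq))
  have := hnn v
  by_cases h : coneForm v = 0 <;> by_cases h0 : v 0 * v 1 = 0 <;> by_cases h3 : v 3 * v 4 = 0 <;>
    simp only [Set.indicator, Set.mem_ofPred_eq, h, h0, h3, if_true, if_false, ne_eq, not_true,
      not_false_eq_true, and_self, and_true, and_false] <;> linarith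

/-! ### Plücker coordinates and absolute convergence -/

open Matrix

/-- The lower half `(C D)` of a symplectic matrix. -/
def lowerRows (γ : Sp2Z) : Matrix (Fin 2) (Fin 2 ⊕ Fin 2) ℤ :=
  (γ : Matrix (Fin 2 ⊕ Fin 2) (Fin 2 ⊕ Fin 2) ℤ).submatrix Sum.inr id

theorem lowerRows_mul (γ γ' : Sp2Z) :
    lowerRows (γ * γ') = lowerRows γ * (γ' : Matrix (Fin 2 ⊕ Fin 2) (Fin 2 ⊕ Fin 2) ℤ) := by
  ext i j
  simp [lowerRows, Matrix.mul_apply]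

/-- The antisymmetric matrix of the `2 × 2` minors of a matrix with two rows. -/
def minors (R : Matrix (Fin 2) (Fin 2 ⊕ Fin 2) ℤ) : Matrix (Fin 2 ⊕ Fin 2) (Fin 2 ⊕ Fin 2) ℤ :=
  Rᵀ * !![0, 1; -1, 0] * R

theorem minors_apply (R : Matrix (Fin 2) (Fin 2 ⊕ Fin 2) ℤ) (i j : Fin 2 ⊕ Fin 2) :
    minors R i j = R 0 i * R 1 j - R 1 i * R 0 j := by
  simp [minors, Matrix.mul_apply, Fin.sum_univ_two]
  ring

theorem minors_mul (R : Matrix (Fin 2) (Fin 2 ⊕ Fin 2) ℤ)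
    (g : Matrix (Fin 2 ⊕ Fin 2) (Fin 2 ⊕ Fin 2) ℤ) : minors (R * g) = gᵀ * minors R * g := by
  simp only [minors, transpose_mul, Matrix.mul_assoc]

/-- The Plücker coordinates of the plane spanned by the rows of `(C D)`. -/
def plucker (γ : Sp2Z) : Fin 5 → ℤ :=
  ![minors (lowerRows γ) (.inl 0) (.inl 1), minors (lowerRows γ) (.inr 0) (.inr 1),
    minors (lowerRows γ) (.inl 0) (.inr 0), minors (lowerRows γ) (.inl 0) (.inr 1),
    minors (lowerRows γ) (.inl 1) (.inr 0)]

theorem blockC_mul_transpose_blockD (γ : Sp2Z) :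
    blockC γ * (blockD γ)ᵀ = blockD γ * (blockC γ)ᵀ := by
  have h := SymplecticGroup.transpose_mem γ.2
  rw [← fromBlocks_toBlocks (γ : Matrix (Fin 2 ⊕ Fin 2) (Fin 2 ⊕ Fin 2) ℤ), fromBlocks_transpose,
    SymplecticGroup.fromBlocks_mem_iff] at h
  simp only [transpose_transpose] at h
  exact h.2.1

/-- The symmetry of `C Dᵀ` makes one of the six minors redundant, which is why five coordinates
suffice. -/
theorem minors_lowerRows_inl_one_inr_one (γ : Sp2Z) :
    minors (lowerRows γ) (.inl 1) (.inr 1) = -minors (lowerRows γ) (.inl 0) (.inr 0) := by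
  have h := congrFun (congrFun (blockC_mul_transpose_blockD γ) 0) 1
  simp only [blockC, blockD, toBlocks₂₁, toBlocks₂₂, Matrix.mul_apply, Fin.sum_univ_two,
    transpose_apply, of_apply] at h
  simp only [minors_apply, lowerRows, submatrix_apply, id]
  linarith

/-- This is the Plücker relation for planes in four-space, with the redundant minor eliminated. -/
theorem coneForm_plucker (γ : Sp2Z) : coneForm (plucker γ) = 0 := by
  have h := minors_lowerRows_inl_one_inr_one γ
  simp only [coneForm, plucker]
  simp only [minors_apply] at h
  simp [minors_apply]
  linear_combination (lowerRows γ 0 (Sum.inl 0) * lowerRows γ 1 (Sum.inr 0) -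
    lowerRows γ 1 (Sum.inl 0) * lowerRows γ 0 (Sum.inr 0)) * h

theorem minors_eq_of_plucker_eq {γ γ' : Sp2Z} (h : plucker γ = plucker γ') :
    minors (lowerRows γ) = minors (lowerRows γ') := by
  have h0 := congrFun h 0
  have h1 := congrFun h 1
  have h2 := congrFun h 2
  have h3 := congrFun h 3
  have h4 := congrFun h 4
  have h5 := minors_lowerRows_inl_one_inr_one γ
  have h6 := minors_lowerRows_inl_one_inr_one γ'
  simp [plucker, minors_apply] at h0 h1 h2 h3 h4 h5 h6
  ext i j
  rw [minors_apply, minors_apply]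
  rcases i with i | i <;> rcases j with j | j <;> fin_cases i <;> fin_cases j <;>
    simp only [Fin.zero_eta, Fin.mk_one, Fin.isValue] <;> linarith

/-- Right multiplication by `γ⁻¹` acts on the minors alone, which reduces the claim to minors equal
to those of `(0 I)`. Then `det D = 1`, and the vanishing of the mixed minors forces `C = 0` by
Cramer's rule. -/
theorem mul_inv_mem_GammaInfPlus_of_plucker_eq {γ γ' : Sp2Z} (h : plucker γ = plucker γ') :
    γ' * γ⁻¹ ∈ GammaInfPlus := by
  have hm : minors (lowerRows (γ' * γ⁻¹)) = minors (lowerRows 1) := by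
    rw [← mul_inv_cancel γ, lowerRows_mul, lowerRows_mul γ, minors_mul, minors_mul,
      minors_eq_of_plucker_eq h]
  have e := fun i j => congrFun (congrFun hm i) j
  simp only [minors_apply] at e
  set g := γ' * γ⁻¹
  have hD : (blockD g).det = 1 := by
    have := e (.inr 0) (.inr 1)
    simp [lowerRows, Matrix.one_apply] at this
    rw [det_fin_two]
    simp only [blockD, toBlocks₂₂, of_apply]
    linarith
  refine ⟨?_, hD⟩
  ext i j
  have h0 := e (.inl j) (.inr 0)
  have h1 := e (.inl j) (.inr 1)
  rw [det_fin_two] at hD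
  simp only [blockD, toBlocks₂₂, of_apply] at hD
  simp [lowerRows, Matrix.one_apply] at h0 h1
  simp only [blockC, toBlocks₂₁, of_apply, Matrix.zero_apply]
  fin_cases i
  · simp only [Fin.zero_eta]
    linear_combination (-(g : Matrix (Fin 2 ⊕ Fin 2) (Fin 2 ⊕ Fin 2) ℤ) (.inr 0) (.inl j)) * hD +
      (g : Matrix (Fin 2 ⊕ Fin 2) (Fin 2 ⊕ Fin 2) ℤ) (.inr 0) (.inr 0) * h1 -
      (g : Matrix (Fin 2 ⊕ Fin 2) (Fin 2 ⊕ Fin 2) ℤ) (.inr 0) (.inr 1) * h0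
  · simp only [Fin.mk_one]
    linear_combination (-(g : Matrix (Fin 2 ⊕ Fin 2) (Fin 2 ⊕ Fin 2) ℤ) (.inr 1) (.inl j)) * hD +
      (g : Matrix (Fin 2 ⊕ Fin 2) (Fin 2 ⊕ Fin 2) ℤ) (.inr 1) (.inr 0) * h1 -
      (g : Matrix (Fin 2 ⊕ Fin 2) (Fin 2 ⊕ Fin 2) ℤ) (.inr 1) (.inr 1) * h0

theorem plucker_ne_zero (γ : Sp2Z) : plucker γ ≠ 0 := by
  intro h
  have h0 := congrFun h 0
  have h1 := congrFun h 1
  have h2 := congrFun h 2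
  have h3 := congrFun h 3
  have h4 := congrFun h 4
  have h5 := minors_lowerRows_inl_one_inr_one γ
  simp [plucker, minors_apply] at h0 h1 h2 h3 h4 h5
  have hm : minors (lowerRows γ) = 0 := by
    ext i j
    rw [minors_apply, Matrix.zero_apply]
    rcases i with i | i <;> rcases j with j | j <;> fin_cases i <;> fin_cases j <;>
      simp only [Fin.zero_eta, Fin.mk_one, Fin.isValue] <;> linarith
  have h1 : minors (lowerRows 1) = 0 := by
    rw [← mul_inv_cancel γ, lowerRows_mul, minors_mul, hm, Matrix.mul_zero, Matrix.zero_mul]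
  have := congrFun (congrFun h1 (.inr 0)) (.inr 1)
  simp [minors_apply, lowerRows, Matrix.one_apply] at this

/-- The linear form in the Plücker coordinates whose value at `(C D)` is `det(Cτ + D)`. -/
def coneLin (τ : Mat2C) (v : Fin 5 → ℝ) : ℂ :=
  v 0 * τ.det + v 1 + v 3 * τ 0 0 - 2 * v 2 * τ 0 1 - v 4 * τ 1 1

/-- Cauchy–Binet for the product of `(C D)` with the column of blocks `τ` and `I`. -/
theorem det_eq_coneLin (γ : Sp2Z) {τ : Mat2C} (hτ : τ.IsSymm) :
    ((blockC γ).map (Int.cast : ℤ → ℂ) * τ + (blockD γ).map (Int.cast : ℤ → ℂ)).det =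
      coneLin τ (toReal (plucker γ)) := by
  have h : τ 1 0 = τ 0 1 := hτ.apply 0 1
  have h5 := congrArg (Int.cast : ℤ → ℂ) (minors_lowerRows_inl_one_inr_one γ)
  simp only [minors_apply, lowerRows, submatrix_apply, id] at h5
  push_cast at h5
  simp [coneLin, toReal, plucker, minors_apply, lowerRows, det_fin_two, Matrix.mul_apply,
    Fin.sum_univ_two, blockC, blockD, toBlocks₂₁, toBlocks₂₂, h]
  linear_combination (τ 0 1) * h5

/-- Where the real and imaginary parts of the linear form both vanish, the quadratic form is
positive definite: `y₁²` times it is the sum of three squares in `key`, with weights positive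
because `det Y > 0`. An isotropic vector there is zero. -/
theorem eq_zero_of_coneLin_eq_zero {τ : Mat2C} (hτ : τ ∈ halfSpace) {v : Fin 5 → ℝ}
    (hv : coneForm v = 0) (h : coneLin τ v = 0) : v = 0 := by
  obtain ⟨hs, hp⟩ := hτ
  have h10 : τ 1 0 = τ 0 1 := hs.apply 0 1
  have hy1 : 0 < (τ 0 0).im := hp.diag_pos (i := 0)
  have hΔ : 0 < (τ 0 0).im * (τ 1 1).im - (τ 0 1).im ^ 2 := by
    have := hp.det_pos
    rw [det_fin_two] at this
    simp only [map_apply, h10] at this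
    linarith
  have hre := congrArg Complex.re h
  have him := congrArg Complex.im h
  simp [coneLin, det_fin_two, h10] at hre him
  set x1 := (τ 0 0).re
  set y1 := (τ 0 0).im
  set x2 := (τ 0 1).re
  set y2 := (τ 0 1).im
  set x3 := (τ 1 1).re
  set y3 := (τ 1 1).im
  unfold coneForm at hv
  have key : y1 ^ 2 * v 0 ^ 2 * (y1 * y3 - y2 ^ 2) +
      ((y1 * (v 2 + v 0 * x2) + y2 * (v 4 - v 0 * x1)) ^ 2 +
        (y1 * y3 - y2 ^ 2) * (v 4 - v 0 * x1) ^ 2) = 0 := by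
    linear_combination y1 ^ 2 * hv - y1 ^ 2 * v 0 * hre - y1 * (v 4 - v 0 * x1) * him
  have p1 : 0 ≤ y1 ^ 2 * v 0 ^ 2 * (y1 * y3 - y2 ^ 2) := by positivity
  have p2 : 0 ≤ (y1 * y3 - y2 ^ 2) * (v 4 - v 0 * x1) ^ 2 := by positivity
  have p3 := sq_nonneg (y1 * (v 2 + v 0 * x2) + y2 * (v 4 - v 0 * x1))
  have e0 : v 0 = 0 := by
    have : y1 ^ 2 * v 0 ^ 2 * (y1 * y3 - y2 ^ 2) = 0 := by linarith
    simpa [hΔ.ne', hy1.ne'] using this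
  have e4 : v 4 = 0 := by
    have : (y1 * y3 - y2 ^ 2) * (v 4 - v 0 * x1) ^ 2 = 0 := by linarith
    simpa [hΔ.ne', e0] using this
  have e2 : v 2 = 0 := by
    have : (y1 * (v 2 + v 0 * x2) + y2 * (v 4 - v 0 * x1)) ^ 2 = 0 := by linarith
    simpa [hy1.ne', e0, e4] using this
  have e3 : v 3 = 0 := by
    simpa [e0, e4, e2, hy1.ne'] using him
  have e1 : v 1 = 0 := by
    simpa [e0, e4, e2, e3] using hre
  ext i
  fin_cases i <;> assumption

theorem coneLin_smul (τ : Mat2C) (a : ℝ) (v : Fin 5 → ℝ) :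
    coneLin τ (a • v) = a * coneLin τ v := by
  simp [coneLin]; ring

/-- The linear form has no zero on the compact set of unit vectors of the cone; homogeneity extends
the bound to the whole cone. -/
theorem exists_le_norm_coneLin {τ : Mat2C} (hτ : τ ∈ halfSpace) :
    ∃ c : ℝ, 0 < c ∧ ∀ v : Fin 5 → ℝ, coneForm v = 0 → c * ‖v‖ ≤ ‖coneLin τ v‖ := by
  let S : Set (Fin 5 → ℝ) := Metric.sphere 0 1 ∩ {v | coneForm v = 0}
  have hSc : IsCompact S := (isCompact_sphere 0 1).inter_right
    (isClosed_eq (by unfold coneForm; fun_prop) continuous_const)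
  have hcont : Continuous fun v : Fin 5 → ℝ => ‖coneLin τ v‖ := by
    unfold coneLin; fun_prop
  obtain ⟨c, hc, h⟩ : ∃ c : ℝ, 0 < c ∧ ∀ v ∈ S, c ≤ ‖coneLin τ v‖ := by
    rcases S.eq_empty_or_nonempty with hS | hS
    · exact ⟨1, one_pos, fun v hv => by simp [hS] at hv⟩
    · obtain ⟨v, hv, hmin⟩ := hSc.exists_isMinOn hS hcont.continuousOn
      refine ⟨‖coneLin τ v‖, norm_pos_iff.2 fun h0 => ?_, fun w hw => hmin hw⟩
      have := eq_zero_of_coneLin_eq_zero hτ hv.2 h0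
      have h1 := hv.1
      simp [this] at h1
  refine ⟨c, hc, fun v hv => ?_⟩
  by_cases h0 : v = 0
  · simp [h0]
  have hn : 0 < ‖v‖ := norm_pos_iff.2 h0
  have hw : ‖v‖⁻¹ • v ∈ S := by
    refine ⟨by simp [norm_smul, hn.ne'], ?_⟩
    show coneForm _ = 0
    unfold coneForm at hv ⊢
    simp only [Pi.smul_apply, smul_eq_mul]
    linear_combination ‖v‖⁻¹ ^ 2 * hv
  have := h _ hw
  rw [coneLin_smul, norm_mul, Complex.norm_real, norm_inv, norm_norm, inv_mul_eq_div,
    le_div_iff₀ hn] at this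
  exact this

theorem one_le_norm_toReal {v : Fin 5 → ℤ} (hv : v ≠ 0) : 1 ≤ ‖toReal v‖ := by
  obtain ⟨i, hi⟩ := Function.ne_iff.1 hv
  refine le_trans ?_ (abs_le_norm_toReal v i)
  exact_mod_cast Int.one_le_abs hi

theorem det_ne_zero_of_mem_halfSpace (γ : Sp2Z) {τ : Mat2C} (hτ : τ ∈ halfSpace) :
    ((blockC γ).map (Int.cast : ℤ → ℂ) * τ + (blockD γ).map (Int.cast : ℤ → ℂ)).det ≠ 0 := by
  rw [det_eq_coneLin γ hτ.1]
  intro h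
  have h1 : coneForm (toReal (plucker γ)) = 0 := by
    have := congrArg (Int.cast : ℤ → ℝ) (coneForm_plucker γ)
    simpa [coneForm, toReal] using this
  have h2 := one_le_norm_toReal (plucker_ne_zero γ)
  rw [eq_zero_of_coneLin_eq_zero hτ h1 h, norm_zero] at h2
  linarith

/-- A nonzero integral vector has norm at least 1, so `c‖v‖ ≥ (c/2)(1 + ‖v‖)`, and distinct indices
give distinct points of the cone. -/
theorem summable_norm_oneSlash {ι : Type*} (g : ι → Sp2Z)
    (hg : Function.Injective fun i => plucker (g i)) {k : ℕ} (hk : 4 ≤ k) {τ : Mat2C}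
    (hτ : τ ∈ halfSpace) : Summable fun i => ‖oneSlash k (g i) τ‖ := by
  obtain ⟨c, hc, h⟩ := exists_le_norm_coneLin hτ
  refine Summable.of_nonneg_of_le (fun i => norm_nonneg _) (fun i => ?_)
    ((summable_cone.comp_injective hg).mul_left ((c / 2) ^ (-(k : ℤ))))
  set v := plucker (g i) with hv
  have hQ : coneForm v = 0 := coneForm_plucker _
  have hQ' : coneForm (toReal v) = 0 := by
    have := congrArg (Int.cast : ℤ → ℝ) hQ
    simpa [coneForm, toReal] using this
  have h1 := one_le_norm_toReal (plucker_ne_zero (g i))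
  have h2 := h _ hQ'
  rw [Function.comp_apply, Set.indicator_of_mem (by exact hQ), oneSlash, det_eq_coneLin _ hτ.1,
    norm_zpow, ← hv]
  have h3 : (c / 2) * (1 + ‖toReal v‖) ≤ ‖coneLin τ (toReal v)‖ := by
    rw [← hv] at h1; nlinarith
  calc ‖coneLin τ (toReal v)‖ ^ (-(k : ℤ)) ≤ ((c / 2) * (1 + ‖toReal v‖)) ^ (-(k : ℤ)) := by
        rw [_root_.zpow_neg, _root_.zpow_neg, zpow_natCast, zpow_natCast]
        gcongr
    _ = (c / 2) ^ (-(k : ℤ)) * (1 + ‖toReal v‖) ^ (-(k : ℤ)) := mul_zpow _ _ _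
    _ ≤ _ := by
        refine mul_le_mul_of_nonneg_left ?_ (by positivity)
        rw [← Real.rpow_intCast]
        refine Real.rpow_le_rpow_of_exponent_le (by linarith) ?_
        push_cast
        have : (4 : ℝ) ≤ k := by exact_mod_cast hk
        linarith

/-- The upper left block `A` of `γ = (A B; C D)`. -/
def blockA (γ : Sp2Z) : Matrix (Fin 2) (Fin 2) ℤ :=
  (γ : Matrix (Fin 2 ⊕ Fin 2) (Fin 2 ⊕ Fin 2) ℤ).toBlocks₁₁

/-- The upper right block `B` of `γ = (A B; C D)`. -/
def blockB (γ : Sp2Z) : Matrix (Fin 2) (Fin 2) ℤ :=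
  (γ : Matrix (Fin 2 ⊕ Fin 2) (Fin 2 ⊕ Fin 2) ℤ).toBlocks₁₂

/-! ### Block relations in the symplectic group -/

theorem coe_eq_fromBlocks (γ : Sp2Z) :
    (γ : Matrix (Fin 2 ⊕ Fin 2) (Fin 2 ⊕ Fin 2) ℤ) =
      fromBlocks (blockA γ) (blockB γ) (blockC γ) (blockD γ) :=
  (fromBlocks_toBlocks _).symm

theorem blockC_mul' (γ γ' : Sp2Z) :
    blockC (γ * γ') = blockC γ * blockA γ' + blockD γ * blockC γ' := blockC_mul γ γ'

theorem blockD_mul' (γ γ' : Sp2Z) :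
    blockD (γ * γ') = blockC γ * blockB γ' + blockD γ * blockD γ' := blockD_mul γ γ'

theorem symplectic_relations (γ : Sp2Z) :
    (blockA γ)ᵀ * blockC γ = (blockC γ)ᵀ * blockA γ ∧
      (blockB γ)ᵀ * blockD γ = (blockD γ)ᵀ * blockB γ ∧
      (blockA γ)ᵀ * blockD γ - (blockC γ)ᵀ * blockB γ = 1 := by
  have h := γ.2
  rwa [coe_eq_fromBlocks, SymplecticGroup.fromBlocks_mem_iff] at h

theorem blockA_mul_transpose_blockD (γ : Sp2Z) :
    blockA γ * (blockD γ)ᵀ - blockB γ * (blockC γ)ᵀ = 1 := by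
  have h := SymplecticGroup.transpose_mem γ.2
  rw [coe_eq_fromBlocks, fromBlocks_transpose, SymplecticGroup.fromBlocks_mem_iff] at h
  simp only [transpose_transpose] at h
  exact h.2.2

/-- The symplectic matrix with given blocks. -/
def ofBlocks (A B C D : Matrix (Fin 2) (Fin 2) ℤ) (h₁ : Aᵀ * C = Cᵀ * A) (h₂ : Bᵀ * D = Dᵀ * B)
    (h₃ : Aᵀ * D - Cᵀ * B = 1) : Sp2Z :=
  ⟨fromBlocks A B C D, SymplecticGroup.fromBlocks_mem_iff.2 ⟨h₁, h₂, h₃⟩⟩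

section ofBlocks

variable {A B C D : Matrix (Fin 2) (Fin 2) ℤ} (h₁ : Aᵀ * C = Cᵀ * A) (h₂ : Bᵀ * D = Dᵀ * B)
  (h₃ : Aᵀ * D - Cᵀ * B = 1)

theorem blockA_ofBlocks : blockA (ofBlocks A B C D h₁ h₂ h₃) = A := toBlocks_fromBlocks₁₁ _ _ _ _
theorem blockB_ofBlocks : blockB (ofBlocks A B C D h₁ h₂ h₃) = B := toBlocks_fromBlocks₁₂ _ _ _ _
theorem blockC_ofBlocks : blockC (ofBlocks A B C D h₁ h₂ h₃) = C := toBlocks_fromBlocks₂₁ _ _ _ _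
theorem blockD_ofBlocks : blockD (ofBlocks A B C D h₁ h₂ h₃) = D := toBlocks_fromBlocks₂₂ _ _ _ _

end ofBlocks

/-! ### The orbit of the cusp -/

theorem blockC_cuspMatrix (d : Fin 2 → ℤ) : blockC (cuspMatrix d) = diagonal d :=
  toBlocks_fromBlocks₂₁ _ _ _ _

theorem blockD_cuspMatrix (d : Fin 2 → ℤ) : blockD (cuspMatrix d) = 1 :=
  toBlocks_fromBlocks₂₂ _ _ _ _

theorem blockC_cuspMatrix_mul (d : Fin 2 → ℤ) (γ : Sp2Z) :
    blockC (cuspMatrix d * γ) = diagonal d * blockA γ + blockC γ := by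
  rw [blockC_mul', blockC_cuspMatrix, blockD_cuspMatrix, Matrix.one_mul]

theorem blockD_cuspMatrix_mul (d : Fin 2 → ℤ) (γ : Sp2Z) :
    blockD (cuspMatrix d * γ) = diagonal d * blockB γ + blockD γ := by
  rw [blockD_mul', blockC_cuspMatrix, blockD_cuspMatrix, Matrix.one_mul]

theorem blockA_cuspMatrix_mul (d : Fin 2 → ℤ) (γ : Sp2Z) :
    blockA (cuspMatrix d * γ) = blockA γ := by
  have : (cuspMatrix d * γ : Sp2Z).1 = fromBlocks 1 0 (diagonal d) 1 * γ.1 := rfl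
  rw [blockA, this, coe_eq_fromBlocks γ, fromBlocks_multiply, toBlocks_fromBlocks₁₁]
  simp

/-- Two symplectic matrices lie in the same coset of `Γ∞⁺` if and only if their lower halves differ
by a factor from `SL₂(ℤ)`. -/
theorem mul_inv_mem_GammaInfPlus_iff (γ γ' : Sp2Z) :
    γ' * γ⁻¹ ∈ GammaInfPlus ↔ ∃ G : Matrix (Fin 2) (Fin 2) ℤ, G.det = 1 ∧
      blockC γ' = G * blockC γ ∧ blockD γ' = G * blockD γ := by
  constructor
  · rintro ⟨hC, hD⟩
    refine ⟨_, hD, ?_, ?_⟩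
    · conv_lhs => rw [← inv_mul_cancel_right γ' γ, blockC_mul', hC, Matrix.zero_mul, zero_add]
    · conv_lhs => rw [← inv_mul_cancel_right γ' γ, blockD_mul', hC, Matrix.zero_mul, zero_add]
  · rintro ⟨G, hG, hC, hD⟩
    have h1 : blockC (γ' * γ⁻¹) = G * blockC (γ * γ⁻¹) := by
      rw [blockC_mul', blockC_mul', hC, hD, Matrix.mul_add, Matrix.mul_assoc, Matrix.mul_assoc]
    have h2 : blockD (γ' * γ⁻¹) = G * blockD (γ * γ⁻¹) := by
      rw [blockD_mul', blockD_mul', hC, hD, Matrix.mul_add, Matrix.mul_assoc, Matrix.mul_assoc]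
    rw [mul_inv_cancel, blockC_one, Matrix.mul_zero] at h1
    rw [mul_inv_cancel, blockD_one, Matrix.mul_one] at h2
    exact ⟨h1, by rw [h2, hG]⟩

/-- The coset of an element of `Γ₀(N)` in the index set of the Eisenstein series. -/
def orbitMk {N : ℕ} (d : Fin 2 → ℤ) (γ : Gamma0 N) : CuspOrbit N d := Quotient.mk _ γ

theorem orbitMk_eq_iff {N : ℕ} {d : Fin 2 → ℤ} {γ γ' : Gamma0 N} :
    orbitMk d γ = orbitMk d γ' ↔ ∃ G : Matrix (Fin 2) (Fin 2) ℤ, G.det = 1 ∧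
      blockC (cuspMatrix d * γ') = G * blockC (cuspMatrix d * γ) ∧
      blockD (cuspMatrix d * γ') = G * blockD (cuspMatrix d * γ) := by
  rw [← mul_inv_mem_GammaInfPlus_iff, orbitMk, orbitMk, Quotient.eq, QuotientGroup.rightRel_apply,
    cuspStabilizer, Subgroup.mem_subgroupOf, Subgroup.mem_comap]
  have : (MulAut.conj (cuspMatrix d)).toMonoidHom ((γ' * γ⁻¹ : Gamma0 N) : Sp2Z) =
      cuspMatrix d * γ' * (cuspMatrix d * γ)⁻¹ := by
    simp [MulAut.conj_apply, mul_assoc]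
  rw [this]

theorem orbitMk_mul_right {N : ℕ} {d : Fin 2 → ℤ} {γ γ' : Gamma0 N} (g : Gamma0 N)
    (h : orbitMk d γ = orbitMk d γ') : orbitMk d (γ * g) = orbitMk d (γ' * g) := by
  rw [orbitMk, orbitMk, Quotient.eq, QuotientGroup.rightRel_apply] at h ⊢
  simpa [mul_assoc] using h

theorem orbitMk_out {N : ℕ} {d : Fin 2 → ℤ} (c : CuspOrbit N d) : orbitMk d (Quotient.out c) = c :=
  Quotient.out_eq c

/-- The cusp is prescribed prime by prime; square-freeness turns this into congruences modulo `N`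
and each `Nᵢ`. -/
theorem dvd_of_forall_prime_dvd {n : ℕ} (hn : Squarefree n) {x : ℤ}
    (h : ∀ p : ℕ, p.Prime → p ∣ n → (p : ℤ) ∣ x) : (n : ℤ) ∣ x := by
  rw [Int.natCast_dvd, ← Nat.prod_primeFactors_of_squarefree hn]
  refine Finset.prod_primes_dvd _ (fun p hp => (Nat.prime_of_mem_primeFactors hp).prime) ?_
  exact fun p hp => Int.natCast_dvd.1
    (h p (Nat.prime_of_mem_primeFactors hp) (Nat.dvd_of_mem_primeFactors hp))

/-! ### Residues of the cusp matrix -/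

section Cusp

variable {N N₀ N₁ N₂ : ℕ} {d : Fin 2 → ℤ}

theorem cast_cusp_zero (h₀ : Squarefree N₀) (hd : IsCuspFor N₀ N₁ N₂ d) (i : Fin 2) :
    ((d i : ℤ) : ZMod N₀) = 0 := by
  rw [ZMod.intCast_zmod_eq_zero_iff_dvd]
  refine dvd_of_forall_prime_dvd h₀ fun p hp hpN => ?_
  rw [← ZMod.intCast_zmod_eq_zero_iff_dvd]
  simpa using congrFun (congrFun ((hd p hp).1 hpN) i) i

theorem cast_cusp_one_zero (h₁ : Squarefree N₁) (hd : IsCuspFor N₀ N₁ N₂ d) :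
    ((d 0 : ℤ) : ZMod N₁) = 1 := by
  rw [← sub_eq_zero, ← Int.cast_one, ← Int.cast_sub, ZMod.intCast_zmod_eq_zero_iff_dvd]
  refine dvd_of_forall_prime_dvd h₁ fun p hp hpN => ?_
  rw [← ZMod.intCast_zmod_eq_zero_iff_dvd, Int.cast_sub, sub_eq_zero]
  simpa using congrFun (congrFun ((hd p hp).2.1 hpN) 0) 0

theorem cast_cusp_one_one (h₁ : Squarefree N₁) (hd : IsCuspFor N₀ N₁ N₂ d) :
    ((d 1 : ℤ) : ZMod N₁) = 0 := by
  rw [ZMod.intCast_zmod_eq_zero_iff_dvd]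
  refine dvd_of_forall_prime_dvd h₁ fun p hp hpN => ?_
  rw [← ZMod.intCast_zmod_eq_zero_iff_dvd]
  simpa using congrFun (congrFun ((hd p hp).2.1 hpN) 1) 1

theorem cast_cusp_two (h₂ : Squarefree N₂) (hd : IsCuspFor N₀ N₁ N₂ d) (i : Fin 2) :
    ((d i : ℤ) : ZMod N₂) = 1 := by
  rw [← sub_eq_zero, ← Int.cast_one, ← Int.cast_sub, ZMod.intCast_zmod_eq_zero_iff_dvd]
  refine dvd_of_forall_prime_dvd h₂ fun p hp hpN => ?_
  rw [← ZMod.intCast_zmod_eq_zero_iff_dvd, Int.cast_sub, sub_eq_zero]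
  simpa using congrFun (congrFun ((hd p hp).2.2 hpN) i) i

/-- The matrix `M_ρ` is idempotent modulo the level. -/
theorem dvd_cusp_sq_sub (hN : Squarefree N) (hρ : N₀ * N₁ * N₂ = N) (hd : IsCuspFor N₀ N₁ N₂ d)
    (i : Fin 2) : (N : ℤ) ∣ d i ^ 2 - d i := by
  refine dvd_of_forall_prime_dvd hN fun p hp hpN => ?_
  rw [← ZMod.intCast_zmod_eq_zero_iff_dvd]
  push_cast
  rw [← hρ, hp.dvd_mul, hp.dvd_mul] at hpN
  rcases hpN with (h | h) | h
  · have := congrFun (congrFun ((hd p hp).1 h) i) i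
    simp at this
    simp [this]
  · have := congrFun (congrFun ((hd p hp).2.1 h) i) i
    fin_cases i <;> simp at this <;> simp [this]
  · have := congrFun (congrFun ((hd p hp).2.2 h) i) i
    simp at this
    simp [this]

end Cusp

/-- The reduction of an integral matrix modulo `n`. -/
abbrev redMod (n : ℕ) (A : Matrix (Fin 2) (Fin 2) ℤ) : Matrix (Fin 2) (Fin 2) (ZMod n) :=
  A.map (Int.castRingHom (ZMod n))

/-! ### Determinants modulo the level and the character -/

theorem redMod_blockC {N n : ℕ} (hn : n ∣ N) (γ : Gamma0 N) : redMod n (blockC (γ : Sp2Z)) = 0 := by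
  ext i j
  simp only [map_apply, Matrix.zero_apply, eq_intCast]
  rw [ZMod.intCast_zmod_eq_zero_iff_dvd]
  exact (Int.natCast_dvd_natCast.2 hn).trans (γ.2 i j)

theorem redMod_blockA_mul_transpose {N n : ℕ} (hn : n ∣ N) (γ : Gamma0 N) :
    redMod n (blockA (γ : Sp2Z)) * (redMod n (blockD (γ : Sp2Z)))ᵀ = 1 := by
  have h := congrArg (redMod n) (blockA_mul_transpose_blockD (γ : Sp2Z))
  simp only [redMod, Matrix.map_sub _ (map_sub (Int.castRingHom (ZMod n))), Matrix.map_mul] at h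
  change _ * (redMod n (blockD (γ : Sp2Z)))ᵀ - _ * (redMod n (blockC (γ : Sp2Z)))ᵀ = _ at h
  rw [redMod_blockC hn, transpose_zero, Matrix.mul_zero, sub_zero,
    Matrix.map_one _ (map_zero _) (map_one _)] at h
  exact h

theorem cast_det (n : ℕ) (A : Matrix (Fin 2) (Fin 2) ℤ) :
    ((A.det : ℤ) : ZMod n) = (redMod n A).det :=
  (Int.castRingHom (ZMod n)).map_det A

theorem det_blockA_mul_det_blockD {N n : ℕ} (hn : n ∣ N) (γ : Gamma0 N) :
    (redMod n (blockA (γ : Sp2Z))).det * (redMod n (blockD (γ : Sp2Z))).det = 1 := by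
  rw [← det_transpose (redMod n (blockD (γ : Sp2Z))), ← det_mul, redMod_blockA_mul_transpose hn,
    det_one]

theorem redMod_mul (n : ℕ) (A B : Matrix (Fin 2) (Fin 2) ℤ) :
    redMod n (A * B) = redMod n A * redMod n B := Matrix.map_mul

theorem redMod_add (n : ℕ) (A B : Matrix (Fin 2) (Fin 2) ℤ) :
    redMod n (A + B) = redMod n A + redMod n B :=
  Matrix.map_add _ (map_add (Int.castRingHom (ZMod n))) _ _

theorem redMod_smul (n : ℕ) (e : ℤ) (A : Matrix (Fin 2) (Fin 2) ℤ) :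
    redMod n (e • A) = (e : ZMod n) • redMod n A := by
  ext i j; simp [-zsmul_eq_mul]

/-- The factor from the primes of `N₁`: a computation in any commutative ring with the matrices
`(M A, M B + D)` for `M = diag(1, 0)`. -/
theorem det_eq_of_rank_one {R : Type*} [CommRing R] {A B D A' B' D' G : Matrix (Fin 2) (Fin 2) R}
    (e : R) (h : A * Dᵀ = 1) (h' : A' * D'ᵀ = 1) (hG : G.det = 1)
    (hC : diagonal ![1, 0] * A' = G * (diagonal ![1, 0] * A))
    (hD : diagonal ![1, 0] * B' + D' = e • (G * (diagonal ![1, 0] * B + D))) :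
    IsUnit (G 1 1) ∧ D'.det = e * G 1 1 ^ 2 * D.det := by
  have h00 := congrFun (congrFun h 0) 0
  have h01 := congrFun (congrFun h 0) 1
  have h'00 := congrFun (congrFun h' 0) 0
  have c00 := congrFun (congrFun hC 0) 0
  have c01 := congrFun (congrFun hC 0) 1
  have c10 := congrFun (congrFun hC 1) 0
  have c11 := congrFun (congrFun hC 1) 1
  have d10 := congrFun (congrFun hD 1) 0
  have d11 := congrFun (congrFun hD 1) 1
  simp only [diagonal_apply_eq, diagonal_apply_ne _ (zero_ne_one (α := Fin 2)),
    diagonal_apply_ne _ (one_ne_zero (α := Fin 2)), cons_val_zero, one_mul, cons_val_one, zero_mul,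
    Matrix.mul_apply, Fin.sum_univ_two, transpose_apply, one_apply_eq, Matrix.add_apply,
    Matrix.smul_apply, smul_eq_mul, zero_add, mul_zero, add_zero,
    one_apply_ne (zero_ne_one (α := Fin 2))]
    at h00 h01 h'00 c00 c01 c10 c11 d10 d11
  rw [det_fin_two] at hG
  rw [det_fin_two, det_fin_two]
  -- `G 1 0` annihilates the first row of `A`, which is unimodular because `A * Dᵀ = 1`. So `G` is
  -- upper triangular with `G 0 0` and `G 1 1` inverse to each other.
  have g10 : G 1 0 = 0 := by linear_combination -(G 1 0) * h00 - D 0 0 * c10 - D 0 1 * c11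
  rw [g10] at hG d10 d11
  have a0 : A 0 0 = G 1 1 * A' 0 0 := by linear_combination -A 0 0 * hG - G 1 1 * c00
  have a1 : A 0 1 = G 1 1 * A' 0 1 := by linear_combination -A 0 1 * hG - G 1 1 * c01
  refine ⟨IsUnit.of_mul_eq_one (G 0 0) (by linear_combination hG), ?_⟩
  -- By Cramer's rule for `A * Dᵀ = 1`, the second row of `D` is `det D` times a rotated first row
  -- of `A`. Expanding `det D'` along its second row then meets the pairing of the first rows of
  -- `A'` and `D'`, which is 1.
  have t1 : D 1 1 = (D 0 0 * D 1 1 - D 0 1 * D 1 0) * A 0 0 := by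
    linear_combination -D 1 1 * h00 + D 0 1 * h01
  have t0 : D 1 0 = -(D 0 0 * D 1 1 - D 0 1 * D 1 0) * A 0 1 := by
    linear_combination -D 1 0 * h00 + D 0 0 * h01
  rw [d10, d11]
  linear_combination e * G 1 1 * (D' 0 0 * t1 - D' 0 1 * t0) +
    e * G 1 1 * (D 0 0 * D 1 1 - D 0 1 * D 1 0) * (D' 0 0 * a0 + D' 0 1 * a1 + G 1 1 * h'00)

/-- The values of the character at the determinants of `D`, for two elements of `Γ₀(N)` whose
translates by `γ_ρ` have lower halves `(C D)` and `(GC, eGD)`. -/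
theorem character_det_eq {N N₀ N₁ N₂ : ℕ} (hN : Squarefree N) (hρ : N₀ * N₁ * N₂ = N)
    {χ : DirichletCharacter ℂ N} {χ₀ : DirichletCharacter ℂ N₀}
    {χ₁ : DirichletCharacter ℂ N₁} {χ₂ : DirichletCharacter ℂ N₂}
    (hχ : ∀ a : ℤ, χ (a : ZMod N) = χ₀ (a : ZMod N₀) * χ₁ (a : ZMod N₁) * χ₂ (a : ZMod N₂))
    (hχ₁ : χ₁ ^ 2 = 1) {d : Fin 2 → ℤ} (hd : IsCuspFor N₀ N₁ N₂ d) (γ γ' : Gamma0 N) (e : ℤ)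
    (G : Matrix (Fin 2) (Fin 2) ℤ) (hG : G.det = 1)
    (hC : blockC (cuspMatrix d * γ') = G * blockC (cuspMatrix d * γ))
    (hD : blockD (cuspMatrix d * γ') = e • (G * blockD (cuspMatrix d * γ))) :
    χ (((blockD (γ' : Sp2Z)).det : ℤ) : ZMod N) =
      χ₀ ((e ^ 2 : ℤ) : ZMod N₀) * χ₁ (e : ZMod N₁) *
        χ (((blockD (γ : Sp2Z)).det : ℤ) : ZMod N) := by
  have hd₀ : N₀ ∣ N := ⟨N₁ * N₂, by rw [← hρ, mul_assoc]⟩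
  have hd₁ : N₁ ∣ N := ⟨N₀ * N₂, by rw [← hρ]; ring⟩
  have hd₂ : N₂ ∣ N := ⟨N₀ * N₁, by rw [← hρ]; ring⟩
  have redC : ∀ n, n ∣ N → redMod n (diagonal d) * redMod n (blockA (γ' : Sp2Z)) =
      redMod n G * (redMod n (diagonal d) * redMod n (blockA (γ : Sp2Z))) := by
    intro n hn
    have := congrArg (redMod n) hC
    rwa [blockC_cuspMatrix_mul, blockC_cuspMatrix_mul, redMod_mul, redMod_add, redMod_add,
      redMod_mul, redMod_mul, redMod_blockC hn, redMod_blockC hn, add_zero, add_zero] at this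
  have redD : ∀ n, redMod n (diagonal d) * redMod n (blockB (γ' : Sp2Z)) +
      redMod n (blockD (γ' : Sp2Z)) = (e : ZMod n) • (redMod n G *
        (redMod n (diagonal d) * redMod n (blockB (γ : Sp2Z)) + redMod n (blockD (γ : Sp2Z)))) := by
    intro n
    have := congrArg (redMod n) hD
    rwa [blockD_cuspMatrix_mul, blockD_cuspMatrix_mul, redMod_smul, redMod_mul, redMod_add,
      redMod_add, redMod_mul, redMod_mul] at this
  have redG : ∀ n, (redMod n G).det = 1 := fun n => by rw [← cast_det, hG, Int.cast_one]
  have redM : ∀ n, redMod n (diagonal d) = diagonal fun i => (d i : ZMod n) := fun n => by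
    rw [redMod, diagonal_map (map_zero _)]; rfl
  -- Here `M_ρ` vanishes, so `D' = eGD` and the determinant acquires `e²`.
  have e₀ : (((blockD (γ' : Sp2Z)).det : ℤ) : ZMod N₀) =
      ((e ^ 2 : ℤ) : ZMod N₀) * (((blockD (γ : Sp2Z)).det : ℤ) : ZMod N₀) := by
    have hM : redMod N₀ (diagonal d) = 0 := by
      rw [redM, funext (cast_cusp_zero (hN.squarefree_of_dvd hd₀) hd)]
      exact diagonal_zero
    have := redD N₀
    rw [hM, Matrix.zero_mul, Matrix.zero_mul, zero_add, zero_add] at this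
    rw [cast_det, cast_det, this, det_smul, det_mul, redG]
    simp
  -- Here `M_ρ` is the identity, so `A' = GA` has the determinant of `A`, and `det D` is the inverse
  -- of `det A`; the factor `e` plays no role.
  have e₂ : (((blockD (γ' : Sp2Z)).det : ℤ) : ZMod N₂) =
      (((blockD (γ : Sp2Z)).det : ℤ) : ZMod N₂) := by
    have hM : redMod N₂ (diagonal d) = 1 := by
      rw [redM, funext (cast_cusp_two (hN.squarefree_of_dvd hd₂) hd)]
      exact diagonal_one
    have h := redC N₂ hd₂
    rw [hM, Matrix.one_mul, Matrix.one_mul] at h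
    have h1 := det_blockA_mul_det_blockD hd₂ γ
    have h2 := det_blockA_mul_det_blockD hd₂ γ'
    rw [h, det_mul, redG, one_mul] at h2
    rw [cast_det, cast_det]
    linear_combination (redMod N₂ (blockD (γ : Sp2Z))).det * h2 -
      (redMod N₂ (blockD (γ' : Sp2Z))).det * h1
  have e₁ : ∃ g : ZMod N₁, IsUnit g ∧ (((blockD (γ' : Sp2Z)).det : ℤ) : ZMod N₁) =
      (e : ZMod N₁) * g ^ 2 * (((blockD (γ : Sp2Z)).det : ℤ) : ZMod N₁) := by
    have hM : redMod N₁ (diagonal d) = diagonal ![1, 0] := by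
      rw [redM]
      congr 1
      ext i
      fin_cases i
      · exact cast_cusp_one_zero (hN.squarefree_of_dvd hd₁) hd
      · exact cast_cusp_one_one (hN.squarefree_of_dvd hd₁) hd
    have h := redC N₁ hd₁
    have h' := redD N₁
    rw [hM] at h h'
    rw [cast_det, cast_det]
    exact ⟨redMod N₁ G 1 1, det_eq_of_rank_one (e : ZMod N₁) (redMod_blockA_mul_transpose hd₁ γ)
      (redMod_blockA_mul_transpose hd₁ γ') (redG _) h h'⟩
  obtain ⟨g, hg, e₁⟩ := e₁
  -- The unit `g` depends on `G`, but only its square occurs, and a quadratic character does not see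
  -- it.
  have hg2 : χ₁ g ^ 2 = 1 := by
    rw [← MulChar.pow_apply' _ two_ne_zero, hχ₁, MulChar.one_apply hg]
  rw [hχ, hχ, e₀, e₁, e₂]
  simp only [map_mul, map_pow]
  rw [hg2]
  ring

/-! ### Scaling `D` by `q` inside the orbit -/

theorem redMod_eq_zero_iff {n : ℕ} {A : Matrix (Fin 2) (Fin 2) ℤ} :
    redMod n A = 0 ↔ ∀ i j, (n : ℤ) ∣ A i j := by
  simp only [← Matrix.ext_iff, map_apply, eq_intCast, Matrix.zero_apply,
    ZMod.intCast_zmod_eq_zero_iff_dvd]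

theorem exists_eq_smul_of_dvd {e : ℤ} {A : Matrix (Fin 2) (Fin 2) ℤ} (h : ∀ i j, e ∣ A i j) :
    ∃ A', A = e • A' := by
  choose A' hA' using h
  exact ⟨of A', by ext i j; simpa using hA' i j⟩

theorem redMod_cusp_mul_self {N N₀ N₁ N₂ : ℕ} (hN : Squarefree N) (hρ : N₀ * N₁ * N₂ = N)
    {d : Fin 2 → ℤ} (hd : IsCuspFor N₀ N₁ N₂ d) :
    redMod N (diagonal d) * redMod N (diagonal d) = redMod N (diagonal d) := by
  rw [← redMod_mul, diagonal_mul_diagonal, ← sub_eq_zero,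
    ← Matrix.map_sub _ (map_sub (Int.castRingHom (ZMod N))), diagonal_sub]
  refine redMod_eq_zero_iff.2 fun i j => ?_
  by_cases h : i = j
  · subst h
    rw [diagonal_apply_eq, ← sq]
    exact dvd_cusp_sq_sub hN hρ hd i
  · rw [diagonal_apply_ne _ h]
    exact dvd_zero _

/-- An integral symplectic matrix `(A B; C D)` with `C ≡ M A (N)` lies in `γ_ρ Γ₀(N)`. -/
theorem exists_cuspMatrix_mul_eq {N : ℕ} (d : Fin 2 → ℤ) (g : Sp2Z)
    (h : redMod N (blockC g) = redMod N (diagonal d) * redMod N (blockA g)) :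
    ∃ γ : Gamma0 N, cuspMatrix d * γ = g := by
  have e : cuspMatrix d * ((cuspMatrix d)⁻¹ * g) = g := mul_inv_cancel_left _ _
  refine ⟨⟨(cuspMatrix d)⁻¹ * g, redMod_eq_zero_iff.1 ?_⟩, e⟩
  have hA := blockA_cuspMatrix_mul d ((cuspMatrix d)⁻¹ * g)
  have hC := congrArg (redMod N) (blockC_cuspMatrix_mul d ((cuspMatrix d)⁻¹ * g))
  rw [e] at hA hC
  rw [← hA, redMod_add, redMod_mul, h] at hC
  exact left_eq_add.1 hC

/-- For invertible `C` the product is `det C` times `A C⁻¹`, which is symmetric because `AᵀC` is. -/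
theorem transpose_mul_adjugate {A C : Matrix (Fin 2) (Fin 2) ℤ} (h : Aᵀ * C = Cᵀ * A) :
    (A * adjugate C)ᵀ = A * adjugate C := by
  have h01 := congrFun (congrFun h 0) 1
  simp only [Matrix.mul_apply, Fin.sum_univ_two, transpose_apply] at h01
  ext i j
  fin_cases i <;> fin_cases j <;>
    simp [Matrix.mul_apply, Fin.sum_univ_two, adjugate_fin_two] <;> linarith

section

variable {N N₀ N₁ N₂ : ℕ} {d : Fin 2 → ℤ} {q : ℕ}

/-- As `q ∣ N₂`, `M_ρ` is the identity modulo `q`, so `C` reduces to the invertible block `A` of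
`γ`. -/
theorem isCoprime_det_blockC (hρ : N₀ * N₁ * N₂ = N) (hd : IsCuspFor N₀ N₁ N₂ d) (hq : q.Prime)
    (hqN : q ∣ N₂) (γ : Gamma0 N) : IsCoprime (q : ℤ) (blockC (cuspMatrix d * γ)).det := by
  have hqN' : q ∣ N := hρ ▸ hqN.mul_left _
  rw [← ZMod.coe_int_isUnit_iff_isCoprime, cast_det, blockC_cuspMatrix_mul, redMod_add, redMod_mul,
    redMod_blockC hqN', add_zero, show redMod q (diagonal d) = 1 from (hd q hq).2.2 hqN,
    Matrix.one_mul]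
  exact IsUnit.of_mul_eq_one _ (det_blockA_mul_det_blockD hqN' γ)

/-- The upper rows for `(C, qD)` are sought as `((A + XC)/q, B + XD)` with `X` symmetric.
Divisibility asks for `X ≡ -AC⁻¹` modulo `q`, and membership in the orbit for `C ≡ M_ρ A'` modulo
`N`. -/
theorem exists_lower_smul (hN : Squarefree N) (hρ : N₀ * N₁ * N₂ = N)
    (hd : IsCuspFor N₀ N₁ N₂ d) (hq : q.Prime) (hqN : q ∣ N₂) (γ : Gamma0 N) :
    ∃ γ' : Gamma0 N, blockC (cuspMatrix d * γ') = blockC (cuspMatrix d * γ) ∧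
      blockD (cuspMatrix d * γ') = (q : ℤ) • blockD (cuspMatrix d * γ) := by
  obtain ⟨N', hN'⟩ : q ∣ N := hρ ▸ hqN.mul_left _
  -- The modulus is `q²` because `A'` must still be controlled modulo `q` after the division by `q`.
  have hcop := (isCoprime_det_blockC hρ hd hq hqN γ).pow_left (m := 2)
  have hcop' : IsCoprime ((q : ℤ) ^ 2) (N' : ℤ) := by
    refine IsCoprime.pow_left (Nat.isCoprime_iff_coprime.2 ?_)
    exact Nat.coprime_of_squarefree_mul (hN' ▸ hN)
  obtain ⟨s, u, hu⟩ := hcop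
  obtain ⟨r, w', hw⟩ := hcop'
  obtain ⟨h₁, h₂, h₃⟩ := symplectic_relations (cuspMatrix d * γ)
  have hCA : redMod N (blockC (cuspMatrix d * γ)) =
      redMod N (diagonal d) * redMod N (blockA (cuspMatrix d * γ)) := by
    rw [blockC_cuspMatrix_mul, blockA_cuspMatrix_mul, redMod_add, redMod_mul,
      redMod_blockC dvd_rfl, add_zero]
  have hadj := transpose_mul_adjugate h₁
  set A := blockA (cuspMatrix d * γ)
  set B := blockB (cuspMatrix d * γ)
  set C := blockC (cuspMatrix d * γ)
  set D := blockD (cuspMatrix d * γ)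
  set w := w' * (N' : ℤ)
  -- `w` is 1 modulo `q²` and 0 modulo `N' = N/q`, while `u` inverts `det C` modulo `q²`. So `X` is
  -- `q - AC⁻¹` modulo `q²`, giving `A' ≡ C` modulo `q`, and `q - 1` modulo `N'`.
  set X : Matrix (Fin 2) (Fin 2) ℤ := ((q : ℤ) - 1) • 1 + w • (1 - u • (A * adjugate C))
  have hX : Xᵀ = X := by
    simp only [X, transpose_add, transpose_smul, transpose_sub, transpose_one, hadj]
  have hAC : A * adjugate C * C = C.det • A := by
    rw [Matrix.mul_assoc, adjugate_mul, Matrix.mul_smul, Matrix.mul_one]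
  set A' : Matrix (Fin 2) (Fin 2) ℤ := C + (q * r : ℤ) • (A - C) + (w * q * s) • A
  have hA' : A + X * C = (q : ℤ) • A' := by
    simp only [X, A', Matrix.add_mul, Matrix.smul_mul, Matrix.sub_mul, Matrix.one_mul, hAC]
    ext i j
    simp only [Matrix.add_apply, Matrix.smul_apply, Matrix.sub_apply, smul_eq_mul]
    linear_combination (-w * A i j) * hu + (C i j - A i j) * hw
  have k₁ : A'ᵀ * C = Cᵀ * A' := by
    simp only [A', transpose_add, transpose_smul, transpose_sub, Matrix.add_mul, Matrix.sub_mul,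
      Matrix.smul_mul, Matrix.mul_add, Matrix.mul_sub, Matrix.mul_smul, h₁]
  clear_value X
  have k₂ : (B + X * D)ᵀ * ((q : ℤ) • D) = ((q : ℤ) • D)ᵀ * (B + X * D) := by
    rw [transpose_add, transpose_mul, hX, transpose_smul, Matrix.mul_smul, Matrix.smul_mul,
      Matrix.add_mul, Matrix.mul_add, h₂, Matrix.mul_assoc]
  have k₃ : A'ᵀ * ((q : ℤ) • D) - Cᵀ * (B + X * D) = 1 := by
    rw [Matrix.mul_smul, ← Matrix.smul_mul, ← transpose_smul, ← hA', transpose_add, transpose_mul,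
      hX, Matrix.add_mul, Matrix.mul_add, Matrix.mul_assoc, add_sub_add_right_eq_sub, h₃]
  obtain ⟨γ', hγ'⟩ := exists_cuspMatrix_mul_eq (N := N) d (ofBlocks _ _ _ _ k₁ k₂ k₃) (by
    rw [blockC_ofBlocks, blockA_ofBlocks]
    have hwq : ((w * q * s : ℤ) : ZMod N) = 0 := by
      rw [ZMod.intCast_zmod_eq_zero_iff_dvd, hN']
      exact ⟨w' * s, by simp only [w]; push_cast; ring⟩
    simp only [A', redMod_add, redMod_smul, hwq, zero_smul, add_zero, sub_eq_add_neg]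
    rw [← neg_one_smul ℤ C, redMod_smul, hCA]
    simp only [Matrix.mul_add, Matrix.mul_smul, ← Matrix.mul_assoc,
      redMod_cusp_mul_self hN hρ hd]
    simp)
  exact ⟨γ', by rw [hγ', blockC_ofBlocks], by rw [hγ', blockD_ofBlocks]⟩

/-- `(qA, B)` completes `(C, D)` to a symplectic matrix. Subtracting `q - 1` times the lower rows
restores `M_ρ A' ≡ qC - (q - 1)C = C` modulo `N`, by idempotence of `M_ρ`. -/
theorem exists_of_lower_smul (hN : Squarefree N) (hρ : N₀ * N₁ * N₂ = N)
    (hd : IsCuspFor N₀ N₁ N₂ d) (hq : q ≠ 0) (γ : Gamma0 N) (D : Matrix (Fin 2) (Fin 2) ℤ)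
    (hD : blockD (cuspMatrix d * γ) = (q : ℤ) • D) :
    ∃ γ' : Gamma0 N, blockC (cuspMatrix d * γ') = blockC (cuspMatrix d * γ) ∧
      blockD (cuspMatrix d * γ') = D := by
  obtain ⟨h₁, h₂, h₃⟩ := symplectic_relations (cuspMatrix d * γ)
  have hCA : redMod N (blockC (cuspMatrix d * γ)) =
      redMod N (diagonal d) * redMod N (blockA (cuspMatrix d * γ)) := by
    rw [blockC_cuspMatrix_mul, blockA_cuspMatrix_mul, redMod_add, redMod_mul,
      redMod_blockC dvd_rfl, add_zero]
  rw [hD] at h₂ h₃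
  set A := blockA (cuspMatrix d * γ)
  set B := blockB (cuspMatrix d * γ)
  set C := blockC (cuspMatrix d * γ)
  have h₂' : Bᵀ * D = Dᵀ * B := by
    rw [transpose_smul, Matrix.mul_smul, Matrix.smul_mul] at h₂
    exact smul_right_injective _ (by exact_mod_cast hq : (q : ℤ) ≠ 0) h₂
  set A' : Matrix (Fin 2) (Fin 2) ℤ := (q : ℤ) • A - ((q : ℤ) - 1) • C
  set B' : Matrix (Fin 2) (Fin 2) ℤ := B - ((q : ℤ) - 1) • D
  have k₁ : A'ᵀ * C = Cᵀ * A' := by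
    simp only [A', transpose_smul, transpose_sub, Matrix.sub_mul,
      Matrix.smul_mul, Matrix.mul_sub, Matrix.mul_smul, h₁]
  have k₂ : B'ᵀ * D = Dᵀ * B' := by
    simp only [B', transpose_smul, transpose_sub, Matrix.sub_mul,
      Matrix.smul_mul, Matrix.mul_sub, Matrix.mul_smul, h₂']
  have k₃ : A'ᵀ * D - Cᵀ * B' = 1 := by
    rw [← h₃]
    simp only [A', B', transpose_smul, transpose_sub, Matrix.sub_mul,
      Matrix.smul_mul, Matrix.mul_sub, Matrix.mul_smul]
    abel
  obtain ⟨γ', hγ'⟩ := exists_cuspMatrix_mul_eq (N := N) d (ofBlocks _ _ _ _ k₁ k₂ k₃) (by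
    rw [blockC_ofBlocks, blockA_ofBlocks]
    simp only [A', redMod_add, redMod_smul, sub_eq_add_neg, ← neg_smul]
    rw [hCA]
    simp only [Matrix.mul_add, Matrix.mul_smul, ← Matrix.mul_assoc,
      redMod_cusp_mul_self hN hρ hd]
    rw [← add_smul]
    push_cast
    ring_nf
    rw [one_smul])
  exact ⟨γ', by rw [hγ', blockC_ofBlocks], by rw [hγ', blockD_ofBlocks]⟩

/-- Conjugation by `δ⁻¹` turns `(A B; C D)` into `(A, B/q; qC, D)`, so divisibility of `B` is the
only condition. -/
theorem mem_heckeSubgroup_of_eq_smul (h : Gamma0 N) (B : Matrix (Fin 2) (Fin 2) ℤ)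
    (hq : q ≠ 0) (hB : blockB (h : Sp2Z) = (q : ℤ) • B) : h ∈ heckeSubgroup N q := by
  obtain ⟨h₁, h₂, h₃⟩ := symplectic_relations (h : Sp2Z)
  rw [hB] at h₂ h₃
  have h₂' : Bᵀ * blockD (h : Sp2Z) = (blockD (h : Sp2Z))ᵀ * B := by
    rw [transpose_smul, Matrix.mul_smul, Matrix.smul_mul] at h₂
    exact smul_right_injective _ (by exact_mod_cast hq : (q : ℤ) ≠ 0) h₂
  refine ⟨⟨ofBlocks (blockA (h : Sp2Z)) B ((q : ℤ) • blockC (h : Sp2Z)) (blockD (h : Sp2Z))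
    (by rw [transpose_smul, Matrix.mul_smul, Matrix.smul_mul, h₁]) h₂'
    (by rw [← h₃, transpose_smul, Matrix.mul_smul, Matrix.smul_mul]), fun i j => ?_⟩, ?_⟩
  · rw [blockC_ofBlocks, Matrix.smul_apply, smul_eq_mul]
    exact (h.2 i j).mul_left _
  · rw [coe_eq_fromBlocks (h : Sp2Z), hB]
    change heckeDelta ℤ q * fromBlocks _ _ _ _ = _
    rw [heckeDelta, fromBlocks_multiply, fromBlocks_multiply]
    simp [(Nat.cast_commute q _).eq]

theorem blockB_of_mem_heckeSubgroup {h : Gamma0 N} (hh : h ∈ heckeSubgroup N q) :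
    ∃ B, blockB (h : Sp2Z) = (q : ℤ) • B := by
  obtain ⟨η, hη⟩ := hh
  refine ⟨blockB (η : Sp2Z), ?_⟩
  rw [coe_eq_fromBlocks (h : Sp2Z), coe_eq_fromBlocks (η : Sp2Z), heckeDelta, fromBlocks_multiply,
      fromBlocks_multiply, fromBlocks_inj] at hη
  simpa using hη.2.1.symm

/-- Uniqueness of the Hecke coset: modulo `q` the right block of `(C, qD)h` is `C` times the block
`B` of `h`, and `C` is invertible. -/
theorem mem_heckeSubgroup_of_lower_smul (hρ : N₀ * N₁ * N₂ = N) (hd : IsCuspFor N₀ N₁ N₂ d)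
    (hq : q.Prime) (hqN : q ∣ N₂) (γ h : Gamma0 N) (D D' : Matrix (Fin 2) (Fin 2) ℤ)
    (hD : blockD (cuspMatrix d * γ) = (q : ℤ) • D)
    (hD' : blockD (cuspMatrix d * (γ * h : Gamma0 N)) = (q : ℤ) • D') : h ∈ heckeSubgroup N q := by
  have hcop := isCoprime_det_blockC hρ hd hq hqN γ
  rw [Subgroup.coe_mul, ← mul_assoc, blockD_mul', hD] at hD'
  set C := blockC (cuspMatrix d * γ)
  have e : C.det • blockB (h : Sp2Z) =
      (q : ℤ) • (adjugate C * (D' - D * blockD (h : Sp2Z))) := by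
    calc C.det • blockB (h : Sp2Z) = adjugate C * (C * blockB (h : Sp2Z)) := by
          rw [← Matrix.mul_assoc, adjugate_mul, Matrix.smul_mul, Matrix.one_mul]
      _ = _ := by
          rw [eq_sub_of_add_eq hD', Matrix.smul_mul, ← smul_sub, Matrix.mul_smul]
  obtain ⟨B, hB⟩ : ∃ B, blockB (h : Sp2Z) = (q : ℤ) • B := by
    refine exists_eq_smul_of_dvd fun i j => hcop.dvd_of_dvd_mul_left ?_
    have := congrFun (congrFun e i) j
    simp only [Matrix.smul_apply, smul_eq_mul] at this
    exact ⟨_, this⟩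
  exact mem_heckeSubgroup_of_eq_smul h B hq.ne_zero hB

/-- The translation by a symmetric integral matrix, as an element of `Γ₀(N)`. -/
def translation (N : ℕ) (s : Matrix (Fin 2) (Fin 2) ℤ) (hs : sᵀ = s) : Gamma0 N :=
  ⟨ofBlocks 1 s 0 1 (by simp) (by simp [hs]) (by simp), fun i j => by
    rw [blockC_ofBlocks]; exact dvd_zero _⟩

/-- Existence of the Hecke coset: translation by the symmetric matrix `s ≡ -C⁻¹D` makes `Cs + D`
vanish modulo `q`. -/
theorem exists_blockD_mul_inv_eq_smul (hρ : N₀ * N₁ * N₂ = N) (hd : IsCuspFor N₀ N₁ N₂ d)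
    (hq : q.Prime) (hqN : q ∣ N₂) (γ : Gamma0 N) :
    ∃ c : Quotient (QuotientGroup.rightRel (heckeSubgroup N q)), ∃ D,
      blockD (cuspMatrix d * (γ * (Quotient.out c)⁻¹ : Gamma0 N)) = (q : ℤ) • D := by
  obtain ⟨a, u, hu⟩ := isCoprime_det_blockC hρ hd hq hqN γ
  have hCD := blockC_mul_transpose_blockD (cuspMatrix d * γ)
  set C := blockC (cuspMatrix d * γ) with hC
  set D := blockD (cuspMatrix d * γ) with hD
  have hs : (-u • (adjugate C * D))ᵀ = -u • (adjugate C * D) := by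
    have := transpose_mul_adjugate (A := Dᵀ) (C := Cᵀ)
      (by rw [transpose_transpose, transpose_transpose, hCD])
    rw [← adjugate_transpose, ← transpose_mul, transpose_transpose] at this
    rw [transpose_smul, ← this]
  set t := translation N _ hs
  have htD : blockD (cuspMatrix d * (γ * t : Gamma0 N)) = (q : ℤ) • (a • D) := by
    rw [Subgroup.coe_mul, ← mul_assoc, blockD_mul', ← hC, ← hD]
    simp only [t, translation, blockB_ofBlocks, blockD_ofBlocks, Matrix.mul_one, Matrix.mul_smul,
      ← Matrix.mul_assoc, mul_adjugate, Matrix.smul_mul, Matrix.one_mul]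
    rw [smul_smul, smul_smul, ← one_smul ℤ D, smul_smul, smul_smul, ← add_smul]
    congr 1
    linear_combination (-1 : ℤ) * hu
  -- The chosen representative differs from `t⁻¹` by an element of the Hecke subgroup; its block `B`
  -- is divisible by `q`, so the divisibility of the right block survives.
  refine ⟨Quotient.mk _ t⁻¹, ?_⟩
  set g := Quotient.out (Quotient.mk (QuotientGroup.rightRel (heckeSubgroup N q)) t⁻¹)
  have hg : t⁻¹ * g⁻¹ ∈ heckeSubgroup N q := by
    rw [← QuotientGroup.rightRel_apply]
    exact Quotient.mk_out t⁻¹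
  obtain ⟨B, hB⟩ := blockB_of_mem_heckeSubgroup hg
  have e : γ * g⁻¹ = γ * t * (t⁻¹ * g⁻¹) := by group
  rw [e, Subgroup.coe_mul, ← mul_assoc, blockD_mul', htD, hB, Matrix.mul_smul, Matrix.smul_mul,
    ← smul_add]
  exact ⟨_, rfl⟩

/-- Elements congruent modulo `q` share a coset. Finiteness ensures that the `finsum` in the Hecke
operator is a genuine sum and not the default value 0. -/
theorem finite_heckeQuotient (hq : q ≠ 0) :
    Finite (Quotient (QuotientGroup.rightRel (heckeSubgroup N q))) := by
  have : NeZero q := ⟨hq⟩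
  let F := RingHom.mapMatrix (m := Fin 2 ⊕ Fin 2) (Int.castRingHom (ZMod q))
  have hinj : Function.Injective
      fun c : Quotient (QuotientGroup.rightRel (heckeSubgroup N q)) =>
        F ((Quotient.out c : Gamma0 N) : Sp2Z) := by
    intro c c' h
    rw [← Quotient.out_eq c, ← Quotient.out_eq c', Quotient.eq, QuotientGroup.rightRel_apply]
    set g := Quotient.out c
    set g' := Quotient.out c'
    have e : F ((g' * g⁻¹ : Gamma0 N) : Sp2Z) = 1 := by
      have h1 : F ((g : Sp2Z) * ((g⁻¹ : Gamma0 N) : Sp2Z) : Sp2Z) = 1 := by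
        rw [← Subgroup.coe_mul, mul_inv_cancel]
        exact map_one F
      rw [Subgroup.coe_mul, Submonoid.coe_mul, map_mul, ← h1, Submonoid.coe_mul, map_mul]
      exact congrArg (· * _) h.symm
    obtain ⟨B, hB⟩ := exists_eq_smul_of_dvd (e := q)
      (A := blockB ((g' * g⁻¹ : Gamma0 N) : Sp2Z)) (fun i j => by
        rw [← ZMod.intCast_zmod_eq_zero_iff_dvd]
        exact (congrFun (congrFun e (.inl i)) (.inr j)).trans (one_apply_ne Sum.inl_ne_inr))
    exact mem_heckeSubgroup_of_eq_smul _ B hq hB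
  exact Finite.of_injective _ hinj

end

/-! ### The Hecke operator on the Eisenstein series -/

section

variable {N N₀ N₁ N₂ : ℕ} {d : Fin 2 → ℤ} {q k : ℕ} {χ : DirichletCharacter ℂ N}

theorem oneSlash_eq_of_lower {γ γ' : Sp2Z} {G : Matrix (Fin 2) (Fin 2) ℤ} (hG : G.det = 1)
    (hC : blockC γ' = G * blockC γ) (hD : blockD γ' = G * blockD γ) (τ : Mat2C) :
    oneSlash k γ' τ = oneSlash k γ τ := by
  have hG' : (G.map (Int.cast : ℤ → ℂ)).det = 1 := by
    have := (Int.castRingHom ℂ).map_det G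
    rw [hG, map_one] at this
    exact this.symm
  have hm : ∀ A : Matrix (Fin 2) (Fin 2) ℤ, (G * A).map (Int.cast : ℤ → ℂ) =
      G.map (Int.cast : ℤ → ℂ) * A.map (Int.cast : ℤ → ℂ) := fun A =>
    Matrix.map_mul (f := Int.castRingHom ℂ)
  rw [oneSlash, oneSlash, hC, hD, hm, hm, Matrix.mul_assoc, ← Matrix.mul_add, det_mul, hG', one_mul]

/-- The case `e = 1` of `character_det_eq`; it makes the choice of representatives by `Quotient.out`
immaterial. -/
theorem eisensteinTerm_eq_of_orbitMk_eq (hN : Squarefree N) (hρ : N₀ * N₁ * N₂ = N)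
    {χ₀ : DirichletCharacter ℂ N₀} {χ₁ : DirichletCharacter ℂ N₁} {χ₂ : DirichletCharacter ℂ N₂}
    (hχ : ∀ a : ℤ, χ (a : ZMod N) = χ₀ (a : ZMod N₀) * χ₁ (a : ZMod N₁) * χ₂ (a : ZMod N₂))
    (hχ₁ : χ₁ ^ 2 = 1) (hd : IsCuspFor N₀ N₁ N₂ d) {γ γ' : Gamma0 N}
    (h : orbitMk d γ = orbitMk d γ') (τ : Mat2C) :
    eisensteinTerm N k χ d γ' τ = eisensteinTerm N k χ d γ τ := by
  obtain ⟨G, hG, hC, hD⟩ := orbitMk_eq_iff.1 h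
  have := character_det_eq hN hρ hχ hχ₁ hd γ γ' 1 G hG hC (by rw [hD, one_smul])
  rw [eisensteinTerm, eisensteinTerm, this, oneSlash_eq_of_lower hG hC hD]
  simp

theorem summable_eisensteinTerm (hk : 4 ≤ k) {τ : Mat2C} (hτ : τ ∈ halfSpace) :
    Summable fun c : CuspOrbit N d => eisensteinTerm N k χ d (Quotient.out c) τ := by
  have hinj : Function.Injective
      fun c : CuspOrbit N d => plucker (cuspMatrix d * (Quotient.out c : Gamma0 N)) := by
    intro c c' h
    rw [← orbitMk_out c, ← orbitMk_out c', orbitMk_eq_iff, ← mul_inv_mem_GammaInfPlus_iff]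
    exact mul_inv_mem_GammaInfPlus_of_plucker_eq h
  refine Summable.of_norm_bounded (summable_norm_oneSlash _ hinj hk hτ) fun c => ?_
  rw [eisensteinTerm, norm_mul, RCLike.norm_conj]
  exact mul_le_of_le_one_left (norm_nonneg _) (χ.norm_le_one _)

/-- Right cosets of the Hecke subgroup, paired with terms of the Eisenstein series, parametrize the
terms of the Eisenstein series: the lower half `(C D)` attached to `c'` goes to `(C, qD) g`, where
`g` represents `c`. -/
theorem exists_heckeEquiv (hN : Squarefree N) (hρ : N₀ * N₁ * N₂ = N) (hd : IsCuspFor N₀ N₁ N₂ d)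
    (hq : q.Prime) (hqN : q ∣ N₂) :
    ∃ (φ : Gamma0 N → Gamma0 N)
      (e : Quotient (QuotientGroup.rightRel (heckeSubgroup N q)) × CuspOrbit N d ≃ CuspOrbit N d),
      (∀ γ, blockC (cuspMatrix d * φ γ) = blockC (cuspMatrix d * γ) ∧
        blockD (cuspMatrix d * φ γ) = (q : ℤ) • blockD (cuspMatrix d * γ)) ∧
      ∀ p, e p = orbitMk d (φ (Quotient.out p.2) * Quotient.out p.1) := by
  choose φ hφC hφD using fun γ => exists_lower_smul hN hρ hd hq hqN γ
  let f : Quotient (QuotientGroup.rightRel (heckeSubgroup N q)) × CuspOrbit N d → CuspOrbit N d :=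
    fun p => orbitMk d (φ (Quotient.out p.2) * Quotient.out p.1)
  have hq0 : (q : ℤ) ≠ 0 := by exact_mod_cast hq.ne_zero
  have hinj : Function.Injective f := by
    rintro ⟨c₁, c₁'⟩ ⟨c₂, c₂'⟩ h
    have h' := orbitMk_mul_right (Quotient.out c₁)⁻¹ h
    simp only [mul_inv_cancel_right] at h'
    -- After translation by the inverse of the first representative, both right blocks are divisible
    -- by `q`, so the quotient of the two representatives lies in the Hecke subgroup.
    have hc : c₁ = c₂ := by
      rw [← Quotient.out_eq c₁, ← Quotient.out_eq c₂, Quotient.eq, QuotientGroup.rightRel_apply]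
      obtain ⟨G, -, -, hD⟩ := orbitMk_eq_iff.1 h'
      rw [hφD, Matrix.mul_smul, mul_assoc] at hD
      exact mem_heckeSubgroup_of_lower_smul hρ hd hq hqN _ _ _ _ (hφD _) hD
    subst hc
    simp only [mul_inv_cancel_right] at h'
    obtain ⟨G, hG, hC, hD⟩ := orbitMk_eq_iff.1 h'
    rw [hφC, hφC] at hC
    rw [hφD, hφD, Matrix.mul_smul] at hD
    have : c₁' = c₂' := by
      rw [← orbitMk_out c₁', ← orbitMk_out c₂', orbitMk_eq_iff]
      exact ⟨G, hG, hC, smul_right_injective _ hq0 hD⟩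
    rw [this]
  have hsurj : Function.Surjective f := by
    intro c
    obtain ⟨b, D, hD⟩ := exists_blockD_mul_inv_eq_smul hρ hd hq hqN (Quotient.out c)
    obtain ⟨γ, hγC, hγD⟩ := exists_of_lower_smul hN hρ hd hq.ne_zero _ D hD
    refine ⟨(b, orbitMk d γ), ?_⟩
    obtain ⟨G, hG, hC, hD'⟩ := orbitMk_eq_iff.1 (orbitMk_out (orbitMk d γ)).symm
    have h : orbitMk d (Quotient.out c * (Quotient.out b)⁻¹) =
        orbitMk d (φ (Quotient.out (orbitMk d γ))) := by
      refine orbitMk_eq_iff.2 ⟨G, hG, ?_, ?_⟩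
      · rw [hφC, hC, hγC]
      · rw [hφD, hD', hγD, hD, Matrix.mul_smul]
    have := orbitMk_mul_right (Quotient.out b) h.symm
    rwa [inv_mul_cancel_right, orbitMk_out] at this
  exact ⟨φ, Equiv.ofBijective f ⟨hinj, hsurj⟩, fun γ => ⟨hφC γ, hφD γ⟩, fun p => rfl⟩

theorem heckeDelta_inv_mul (hq : q ≠ 0) (g : Sp2Z) :
    (heckeDelta ℝ q)⁻¹ *
      (g : Matrix (Fin 2 ⊕ Fin 2) (Fin 2 ⊕ Fin 2) ℤ).map (Int.cast : ℤ → ℝ) =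
      fromBlocks ((q : ℝ)⁻¹ • (blockA g).map (Int.cast : ℤ → ℝ))
        ((q : ℝ)⁻¹ • (blockB g).map (Int.cast : ℤ → ℝ))
        ((blockC g).map (Int.cast : ℤ → ℝ)) ((blockD g).map (Int.cast : ℤ → ℝ)) := by
  have hq' : (q : ℝ) ≠ 0 := by exact_mod_cast hq
  have hinv : (heckeDelta ℝ q)⁻¹ = fromBlocks ((q : ℝ)⁻¹ • 1) 0 0 1 := by
    refine Matrix.inv_eq_left_inv ?_
    rw [heckeDelta, fromBlocks_multiply]
    simp [smul_smul, hq']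
  rw [hinv, coe_eq_fromBlocks g, fromBlocks_map, fromBlocks_multiply]
  simp

theorem det_heckeDelta_inv_mul (g : Sp2Z) :
    ((heckeDelta ℝ q)⁻¹ *
      (g : Matrix (Fin 2 ⊕ Fin 2) (Fin 2 ⊕ Fin 2) ℤ).map (Int.cast : ℤ → ℝ)).det =
      ((q : ℝ) ^ 2)⁻¹ := by
  have hg : ((g : Matrix (Fin 2 ⊕ Fin 2) (Fin 2 ⊕ Fin 2) ℤ).map (Int.cast : ℤ → ℝ)).det = 1 := by
    have := (Int.castRingHom ℝ).map_det (g : Matrix (Fin 2 ⊕ Fin 2) (Fin 2 ⊕ Fin 2) ℤ)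
    rw [SymplecticGroup.det_eq_one g.2, map_one] at this
    exact this.symm
  rw [det_mul, hg, mul_one, det_nonsing_inv, heckeDelta, det_fromBlocks_zero₁₂, det_smul]
  simp

/-- The effect on a summand of the slash action of `δ⁻¹ g`. -/
theorem slash_oneSlash (hq : q ≠ 0) {P P' : Sp2Z} (g : Sp2Z) (hC : blockC P' = blockC P)
    (hD : blockD P' = (q : ℤ) • blockD P) {τ : Mat2C} (hτ : τ ∈ halfSpace) :
    slash k (oneSlash k P) ((heckeDelta ℝ q)⁻¹ *
      (g : Matrix (Fin 2 ⊕ Fin 2) (Fin 2 ⊕ Fin 2) ℤ).map (Int.cast : ℤ → ℝ)) τ =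
      (q : ℂ) ^ k * oneSlash k (P' * g) τ := by
  have hqR : (0 : ℝ) < q := by exact_mod_cast Nat.pos_of_ne_zero hq
  have hqC : (q : ℂ) ≠ 0 := by exact_mod_cast hq
  have hpow : (((q : ℝ) ^ 2)⁻¹) ^ ((k : ℝ) / 2) = ((q : ℝ) ^ k)⁻¹ := by
    rw [Real.inv_rpow (by positivity), ← Real.rpow_natCast (q : ℝ) 2, ← Real.rpow_mul hqR.le,
      ← Real.rpow_natCast (q : ℝ) k]
    congr 2
    push_cast
    ring
  have hmap : ∀ A : Matrix (Fin 2) (Fin 2) ℤ,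
      (A.map (Int.cast : ℤ → ℝ)).map Complex.ofReal = A.map (Int.cast : ℤ → ℂ) := by
    intro A; ext i j; simp
  have hmap' : ∀ A : Matrix (Fin 2) (Fin 2) ℤ,
      ((q : ℝ)⁻¹ • A.map (Int.cast : ℤ → ℝ)).map Complex.ofReal =
        (q : ℂ)⁻¹ • A.map (Int.cast : ℤ → ℂ) := by
    intro A; ext i j; simp
  have hm : ∀ A B : Matrix (Fin 2) (Fin 2) ℤ, (A * B).map (Int.cast : ℤ → ℂ) =
      A.map (Int.cast : ℤ → ℂ) * B.map (Int.cast : ℤ → ℂ) := fun A B =>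
    Matrix.map_mul (f := Int.castRingHom ℂ)
  have ha : ∀ A B : Matrix (Fin 2) (Fin 2) ℤ, (A + B).map (Int.cast : ℤ → ℂ) =
      A.map (Int.cast : ℤ → ℂ) + B.map (Int.cast : ℤ → ℂ) := fun A B =>
    Matrix.map_add _ (map_add (Int.castRingHom ℂ)) _ _
  have hs : ∀ A : Matrix (Fin 2) (Fin 2) ℤ, ((q : ℤ) • A).map (Int.cast : ℤ → ℂ) =
      (q : ℂ) • A.map (Int.cast : ℤ → ℂ) := by
    intro A; ext i j
    simp only [map_apply, Matrix.smul_apply, smul_eq_mul, Int.cast_mul, Int.cast_natCast]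
  have hj := det_ne_zero_of_mem_halfSpace g hτ
  simp only [slash]
  rw [det_heckeDelta_inv_mul, heckeDelta_inv_mul hq, toBlocks_fromBlocks₁₁, toBlocks_fromBlocks₁₂,
    toBlocks_fromBlocks₂₁, toBlocks_fromBlocks₂₂, hmap', hmap', hmap, hmap, hpow, oneSlash, oneSlash,
    blockC_mul', blockD_mul', hC, hD, ha, ha, hm, hm, hm, hm, hs]
  set a := (blockA g).map (Int.cast : ℤ → ℂ)
  set b := (blockB g).map (Int.cast : ℤ → ℂ)
  set c := (blockC g).map (Int.cast : ℤ → ℂ)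
  set e := (blockD g).map (Int.cast : ℤ → ℂ)
  set C := (blockC P).map (Int.cast : ℤ → ℂ)
  set D := (blockD P).map (Int.cast : ℤ → ℂ)
  set J := c * τ + e
  set Y := (C * a + (q : ℂ) • D * c) * τ + (C * b + (q : ℂ) • D * e) with hY
  -- The determinant of this is `q⁻² det Y / det J`. Its power `-k` yields `q ^ (2k)` and a factor
  -- that cancels the automorphy factor of `g`; the normalisation `q ^ (-k)` leaves `q ^ k`.
  have hYJ : C * (((q : ℂ)⁻¹ • a * τ + (q : ℂ)⁻¹ • b) * J⁻¹) + D = (q : ℂ)⁻¹ • (Y * J⁻¹) := by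
    have hJ : J * J⁻¹ = 1 := Matrix.mul_nonsing_inv _ (isUnit_iff_ne_zero.2 hj)
    have e1 : Y = C * (a * τ + b) + (q : ℂ) • (D * J) := by
      simp only [hY, J, Matrix.add_mul, Matrix.mul_add, Matrix.smul_mul, smul_add,
        Matrix.mul_assoc]
      abel
    clear_value Y J
    calc _ = (q : ℂ)⁻¹ • (C * (a * τ + b) * J⁻¹) + (q : ℂ)⁻¹ • (q : ℂ) • (D * (J * J⁻¹)) := by
          rw [hJ, Matrix.mul_one, smul_smul _ (q : ℂ), inv_mul_cancel₀ hqC, one_smul,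
            Matrix.smul_mul, ← smul_add, Matrix.smul_mul, Matrix.mul_smul, Matrix.mul_assoc C]
      _ = _ := by rw [e1, Matrix.add_mul, smul_add, Matrix.smul_mul, Matrix.mul_assoc D]
  rw [hYJ, det_smul, det_mul, det_nonsing_inv, Ring.inverse_eq_inv', Fintype.card_fin]
  simp only [zpow_natCast, mul_pow, inv_pow, Complex.ofReal_inv, Complex.ofReal_pow,
    Complex.ofReal_natCast, _root_.zpow_neg]
  have hjk : J.det ^ k ≠ 0 := pow_ne_zero _ hj
  have hqk : (q : ℂ) ^ k ≠ 0 := pow_ne_zero _ hqC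
  rw [mul_inv, mul_inv, inv_inv, inv_inv, ← pow_mul, mul_comm 2 k, pow_mul]
  field_simp

theorem slash_eisenstein (hq : q ≠ 0) (g : Sp2Z) {φ : Gamma0 N → Gamma0 N}
    (hφ : ∀ γ, blockC (cuspMatrix d * φ γ) = blockC (cuspMatrix d * γ) ∧
      blockD (cuspMatrix d * φ γ) = (q : ℤ) • blockD (cuspMatrix d * γ))
    {τ : Mat2C} (hτ : τ ∈ halfSpace) :
    slash k (eisenstein N k χ d) ((heckeDelta ℝ q)⁻¹ *
      (g : Matrix (Fin 2 ⊕ Fin 2) (Fin 2 ⊕ Fin 2) ℤ).map (Int.cast : ℤ → ℝ)) τ =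
      1 / 2 * ∑' c : CuspOrbit N d, (q : ℂ) ^ k *
        (conj (χ (((blockD ((Quotient.out c : Gamma0 N) : Sp2Z)).det : ℤ) : ZMod N)) *
          oneSlash k (cuspMatrix d * φ (Quotient.out c) * g) τ) := by
  -- At a fixed `τ` the slash action is a constant times evaluation at one point, so it passes
  -- through the infinite sum.
  obtain ⟨a, x, h⟩ : ∃ (a : ℂ) (x : Mat2C), ∀ f : Mat2C → ℂ, slash k f ((heckeDelta ℝ q)⁻¹ *
      (g : Matrix (Fin 2 ⊕ Fin 2) (Fin 2 ⊕ Fin 2) ℤ).map (Int.cast : ℤ → ℝ)) τ = a * f x :=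
    ⟨_, _, fun _ => rfl⟩
  rw [h, eisenstein, mul_left_comm, ← tsum_mul_left]
  congr 2
  ext c
  have := slash_oneSlash (k := k) hq g (hφ (Quotient.out c)).1 (hφ (Quotient.out c)).2 hτ
  rw [h] at this
  rw [eisensteinTerm, mul_left_comm, this, mul_left_comm]

theorem heckeT_eisenstein (hk : 4 ≤ k) (hN : Squarefree N) (hρ : N₀ * N₁ * N₂ = N)
    {χ₀ : DirichletCharacter ℂ N₀} {χ₁ : DirichletCharacter ℂ N₁} {χ₂ : DirichletCharacter ℂ N₂}
    (hχ : ∀ a : ℤ, χ (a : ZMod N) = χ₀ (a : ZMod N₀) * χ₁ (a : ZMod N₁) * χ₂ (a : ZMod N₂))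
    (hχ₁ : χ₁ ^ 2 = 1) (hd : IsCuspFor N₀ N₁ N₂ d) (hq : q.Prime) (hqN₂ : q ∣ N₂) {τ : Mat2C}
    (hτ : τ ∈ halfSpace) :
    heckeT N k χ q (eisenstein N k χ d) τ =
      χ₀ ((q ^ 2 : ℕ) : ZMod N₀) * χ₁ (q : ZMod N₁) * (q : ℂ) ^ (2 * (k : ℤ) - 3)
        * eisenstein N k χ d τ := by
  have hsum := summable_eisensteinTerm (N := N) (d := d) (χ := χ) hk hτ
  obtain ⟨φ, e, hφ, he⟩ := exists_heckeEquiv hN hρ hd hq hqN₂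
  have hqC : (q : ℂ) ≠ 0 := by exact_mod_cast hq.ne_zero
  set ε : ℂ := χ₀ ((q ^ 2 : ℕ) : ZMod N₀) * χ₁ (q : ZMod N₁) with hε
  -- `q` is coprime to `N₀N₁`, so `ε` has absolute value 1. Conjugating `χ(det D') = ε χ(det D)`
  -- therefore moves `ε` itself, unconjugated, to the other side.
  have hε1 : ε * conj ε = 1 := by
    have hcop : (N₀ * N₁).Coprime q :=
      (Nat.coprime_of_squarefree_mul (hρ ▸ hN)).coprime_dvd_right hqN₂
    have u₀ : IsUnit ((q ^ 2 : ℕ) : ZMod N₀) :=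
      (ZMod.isUnit_iff_coprime _ _).2 (hcop.symm.coprime_dvd_right (dvd_mul_right _ _) |>.pow_left 2)
    have u₁ : IsUnit (q : ZMod N₁) :=
      (ZMod.isUnit_iff_coprime _ _).2 (hcop.symm.coprime_dvd_right (dvd_mul_left _ _))
    rw [RCLike.mul_conj, hε, norm_mul, ← u₀.unit_spec, ← u₁.unit_spec,
      DirichletCharacter.unit_norm_eq_one, DirichletCharacter.unit_norm_eq_one]
    simp
  have hterm : ∀ p : Quotient (QuotientGroup.rightRel (heckeSubgroup N q)) × CuspOrbit N d,
      conj (χ (((blockD ((Quotient.out p.1 : Gamma0 N) : Sp2Z)).det : ℤ) : ZMod N)) *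
        ((q : ℂ) ^ k *
          (conj
              (χ (((blockD ((Quotient.out p.2 : Gamma0 N) : Sp2Z)).det : ℤ) : ZMod N)) *
            oneSlash k (cuspMatrix d * φ (Quotient.out p.2) * (Quotient.out p.1 : Gamma0 N)) τ)) =
      (q : ℂ) ^ k * ε * eisensteinTerm N k χ d (Quotient.out (e p)) τ := by
    rintro ⟨b, c⟩
    set g := Quotient.out b
    set γ := Quotient.out c
    have h1 : eisensteinTerm N k χ d (Quotient.out (e (b, c))) τ =
        eisensteinTerm N k χ d (φ γ * g) τ :=
      (eisensteinTerm_eq_of_orbitMk_eq hN hρ hχ hχ₁ hd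
        ((he (b, c)).symm.trans (orbitMk_out _).symm) τ)
    have h2 := character_det_eq hN hρ hχ hχ₁ hd γ (φ γ) q 1 Matrix.det_one
      (by rw [(hφ γ).1, Matrix.one_mul]) (by rw [(hφ γ).2, Matrix.one_mul])
    have h2' : χ (((blockD ((φ γ : Gamma0 N) : Sp2Z)).det : ℤ) : ZMod N) =
        ε * χ (((blockD (γ : Sp2Z)).det : ℤ) : ZMod N) := by
      rw [h2, hε]; push_cast; rfl
    have h3 : (((blockD ((φ γ * g : Gamma0 N) : Sp2Z)).det : ℤ) : ZMod N) =
        (((blockD (φ γ : Sp2Z)).det : ℤ) : ZMod N) * (((blockD (g : Sp2Z)).det : ℤ) : ZMod N) := by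
      rw [Subgroup.coe_mul, blockD_mul', cast_det, redMod_add, redMod_mul, redMod_mul,
        redMod_blockC dvd_rfl, Matrix.zero_mul, zero_add, Matrix.det_mul, cast_det, cast_det]
    rw [h1, eisensteinTerm, h3, map_mul, h2', map_mul, map_mul, Subgroup.coe_mul, ← mul_assoc
      (cuspMatrix d)]
    linear_combination (-(q : ℂ) ^ k *
      conj (χ (((blockD (γ : Sp2Z)).det : ℤ) : ZMod N)) *
      conj (χ (((blockD (g : Sp2Z)).det : ℤ) : ZMod N)) *
      oneSlash k (cuspMatrix d * φ γ * g) τ) * hε1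
  have : Finite (Quotient (QuotientGroup.rightRel (heckeSubgroup N q))) :=
    finite_heckeQuotient hq.ne_zero
  have := Fintype.ofFinite (Quotient (QuotientGroup.rightRel (heckeSubgroup N q)))
  -- Summability over all pairs, transported along the bijection, is what permits merging the two
  -- sums.
  have hsum' := (e.summable_iff.2 hsum).mul_left ((q : ℂ) ^ k * ε)
  rw [heckeT, finsum_eq_sum_of_fintype]
  simp_rw [slash_eisenstein hq.ne_zero _ hφ hτ, mul_left_comm _ (1 / 2 : ℂ)]
  rw [← Finset.mul_sum]
  simp_rw [← tsum_mul_left]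
  rw [← tsum_fintype (L := .unconditional _)]
  have key : (∑' b : Quotient (QuotientGroup.rightRel (heckeSubgroup N q)),
      ∑' c : CuspOrbit N d, (q : ℂ) ^ k * ε * eisensteinTerm N k χ d (Quotient.out (e (b, c))) τ) =
      (q : ℂ) ^ k * ε * ∑' c : CuspOrbit N d, eisensteinTerm N k χ d (Quotient.out c) τ := by
    rw [← Summable.tsum_prod (f := fun p => (q : ℂ) ^ k * ε *
      eisensteinTerm N k χ d (Quotient.out (e p)) τ) hsum', tsum_mul_left,
      e.tsum_eq fun c => eisensteinTerm N k χ d (Quotient.out c) τ]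
  simp_rw [fun b c => hterm (b, c)]
  rw [key, eisenstein, show (2 * (k : ℤ) - 3) = ((k : ℤ) - 3) + k by ring, zpow_add₀ hqC,
    zpow_natCast]
  ring

end

end SiegelDegTwo

end

theorem proposition3p5 (k N N₀ N₁ N₂ : ℕ) (hk : 4 ≤ k) (hN : Squarefree N)
    (hρ : N₀ * N₁ * N₂ = N)
    (χ : DirichletCharacter ℂ N) (χ₀ : DirichletCharacter ℂ N₀)
    (χ₁ : DirichletCharacter ℂ N₁) (χ₂ : DirichletCharacter ℂ N₂)
    (hχ : ∀ a : ℤ, χ (a : ZMod N) = χ₀ (a : ZMod N₀) * χ₁ (a : ZMod N₁) * χ₂ (a : ZMod N₂))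
    (hχ₁ : χ₁ ^ 2 = 1)
    (d : Fin 2 → ℤ) (hd : SiegelDegTwo.IsCuspFor N₀ N₁ N₂ d)
    (q : ℕ) (hq : q.Prime) (hqN₂ : q ∣ N₂) :
    ∀ τ ∈ SiegelDegTwo.halfSpace,
      Summable (fun c : SiegelDegTwo.CuspOrbit N d =>
        SiegelDegTwo.eisensteinTerm N k χ d (Quotient.out c) τ) ∧
      SiegelDegTwo.heckeT N k χ q (SiegelDegTwo.eisenstein N k χ d) τ =
        χ₀ ((q ^ 2 : ℕ) : ZMod N₀) * χ₁ (q : ZMod N₁) * (q : ℂ) ^ (2 * (k : ℤ) - 3)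
          * SiegelDegTwo.eisenstein N k χ d τ := by
  intro τ hτ
  exact ⟨SiegelDegTwo.summable_eisensteinTerm hk hτ,
    SiegelDegTwo.heckeT_eisenstein hk hN hρ hχ hχ₁ hd hq hqN₂ hτ⟩
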